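/- **Setting.** Let $\mathcal C$ be a class of measurable concepts $X\to\{-1,+1\}$ of finite VC dimension at most $d$, $c\in\mathcal C$ the target and $\mathcal D$ a probability distribution on $X$. There are $n\ge 1$ workers; worker $i$ has error rates $\eta_i^+,\eta_i^-\in[0,\tfrac12]$: each example drawn from $\mathcal D$ with $c(x)=+1$ (with $c(x)=-1$) is mislabelled by worker $i$ with probability $\eta_i^+$ (with probability $\eta_i^-$), independently over the workers and over the drawn examples; a worker asked twice about the same drawn example repeats its label. Put $\bar\eta_W^{\pm}=\frac1n\sum_i\eta_i^{\pm}$ and $\hat\eta_i=\eta_i^+\Pr_{\mathcal D}[c(x)=1]+\eta_i^-\Pr_{\mathcal D}[c(x)=-1]$, and let $i^*$ be a worker that minimises $\hat\eta_i$. A task is one request to one worker to label one drawn example. A learner draws unlabelled examples and uniformly random workers and then runs a straight-line program that can add and compare numbers, select among stored numbers and hypotheses, ask workers for labels, evaluate hypotheses on the drawn examples, and call a (jointly measurable) oracle that returns, for any finite labelled sample, a concept in $\mathcal C$ with the fewest disagreements with the sample. Its running time counts every draw and every instruction, an oracle call being charged the size of its sample and the loading of a numerical constant being charged the value of the constant.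 **Theorem.** There are universal constants $A,K>0$ and $k\in\mathbb N$ with the following property. Let $\epsilon>0$, $0<\delta\le\frac12$, let $n\ge1$ and $d\ge 0$ be integers, and let $M,b,m\in[0,\tfrac12)$. Suppose that the crowd is large enough for the majority votes: $$n\ \ge\ A\,\frac{\log(T/\delta)}{(1-2M)^2},\qquad T=\frac{\log(n/\delta)}{(1-2b)^2}.$$ Let $$B=\frac{\log^2(n/\delta)}{(1-2M)^2(1-2b)^2}+\Big(n+\frac d\epsilon\Big)\frac{\log(1/\delta)}{(1-2m)^2}.$$ Then there is a learner, depending only on $n,d,\epsilon,\delta,M,b,m$, that always uses at most $K\,B\,\log^k(B+2)=\tilde{\mathcal O}(B)$ tasks, runs in time at most $K\big(n+d+\frac1\epsilon+\frac1\delta+\frac1{1-2M}+\frac1{1-2b}+\frac1{1-2m}\big)^k$, and PAC learns: for all $X$, $\mathcal C$ of VC dimension at most $d$, $\mathcal D$, $c\in\mathcal C$, disagreement-minimising oracles, error rates and minimisers $i^*$ as above with $$\max(\bar\eta_W^+,\bar\eta_W^-)\le M,\qquad \hat\eta_{i^*}\le b,\qquad \max(\eta_{i^*}^+,\eta_{i^*}^-)\le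 m,$$ its output $h$ always lies in $\mathcal C$, and $\Pr\big[\Pr_{x\sim\mathcal D}(h(x)\ne c(x))\ge\epsilon\big]\le\delta$. In particular, with equality in the last three bounds, $\mathcal C$ can be efficiently PAC learned with $$\tilde{\mathcal O}\!\left(\frac{\log^2(n/\delta)}{(1-2\max(\bar\eta_W^+,\bar\eta_W^-))^2(1-2\hat\eta_{i^*})^2}+\Big(n+\frac d\epsilon\Big)\frac{\log(1/\delta)}{(1-2\max(\eta_{i^*}^+,\eta_{i^*}^-))^2}\right)$$ tasks. -/

import Mathlib

open MeasureTheory ProbabilityTheory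

noncomputable section

namespace CrowdPAC

/-! ## Concept classes, VC dimension, disagreement minimisation

A concept is a map `X → Bool`; `true` is the label `+1` and `false` the label `-1`. -/

/-- `C` realises every labelling of the finite set `A`. -/
def Shatters {X : Type*} (C : Set (X → Bool)) (A : Finset X) : Prop :=
  ∀ t : X → Bool, ∃ h ∈ C, ∀ x ∈ A, h x = t x

/-- The Vapnik–Chervonenkis dimension. -/
def vcDim {X : Type*} (C : Set (X → Bool)) : ℕ∞ :=
  ⨆ (A : Finset X) (_ : Shatters C A), (A.card : ℕ∞)

/-- The number of entries of the labelled sample `S` with which `h` disagrees. -/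
def disagreements {X : Type*} (h : X → Bool) (S : List (X × Bool)) : ℕ :=
  S.countP fun z => h z.1 != z.2

/-- `erm` is a disagreement minimiser for `C`: on each labelled sample it returns a concept of `C`
with the least number of disagreements. The last field is joint measurability of
`(S, x) ↦ erm S x` for samples `S` of each fixed size. -/
structure IsMinimizer {X : Type*} [MeasurableSpace X] (C : Set (X → Bool))
    (erm : List (X × Bool) → X → Bool) : Prop where
  mem : ∀ S, erm S ∈ C
  le : ∀ S, ∀ h ∈ C, disagreements (erm S) S ≤ disagreements h S
  measurable : ∀ m : ℕ,
    Measurable fun p : (Fin m → X × Bool) × X => erm (List.ofFn p.1) p.2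

/-! ## Crowds with asymmetric (Dawid–Skene) classification noise

A crowd of `n` workers is given by `η : Fin n → Bool → [0, 1]`, where `η i true` and `η i false` are the
error rates of worker `i` on positive and on negative examples. -/

/-- The average error rate of the crowd on examples whose true label is `b`. -/
def avgError {n : ℕ} (η : Fin n → Bool → unitInterval) (b : Bool) : ℝ :=
  (∑ i, (η i b : ℝ)) / n

/-- The class-weighted error rate of worker `i`, for the target `c` and the distribution `D`. -/
def weightedError {X : Type*} [MeasurableSpace X] {n : ℕ} (η : Fin n → Bool → unitInterval)
    (D : Measure X) (c : X → Bool) (i : Fin n) : ℝ :=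
  η i true * D.real {x | c x = true} + η i false * D.real {x | c x = false}

/-- A data point: an example together with its persistent noise. `z.2 i b` tells whether worker `i`
errs on the data point `z` in case that its true label is `b`. -/
abbrev DataPoint (X : Type*) (n : ℕ) : Type _ := X × (Fin n → Bool → Bool)

/-- The label that worker `i` gives to a data point, each time that it is asked. -/
def DataPoint.label {X : Type*} {n : ℕ} (c : X → Bool) (z : DataPoint X n) (i : Fin n) : Bool :=
  xor (c z.1) (z.2 i (c z.1))

/-- The law of a data point: the example has law `D`, and the workers err independently of the
example and of each other, at their own error rates. -/
def dataLaw {X : Type*} [MeasurableSpace X] {n : ℕ} (η : Fin n → Bool → unitInterval) (D : Measure X) :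
    Measure (DataPoint X n) :=
  D.prod (Measure.pi fun i => Measure.pi fun b => bernoulliMeasure true false (η i b))

/-! ## Learners

A learner draws unlabelled data points and uniformly random workers and then runs a straight-line
program over number registers and hypothesis registers. It has access to the data points only
through the labels given by workers, through the disagreement minimiser, and through the values of
hypotheses that the minimiser has returned. -/

/-- The instructions of a learner that has drawn `s` data points; `r a b u v w` are numbers of
number registers, `g h h'` are numbers of hypothesis registers. -/
inductive Instr (s : ℕ) : Type
  /-- `r := v` for a constant `v`. -/
  | const (r v : ℕ)
  /-- `r := a + b`. -/
  | add (r a b : ℕ)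
  /-- `r := if a ≤ b then u else v`. -/
  | select (r a b u v : ℕ)
  /-- `r :=` the label given to the data point `e` by the worker whose number is in `w`: one task.
  (Label `+1` is stored as `1` and label `-1` as `0`.) -/
  | query (r w : ℕ) (e : Fin s)
  /-- `g :=` the output of the disagreement minimiser on the listed data points, each labelled by
  the number register that is listed with it. -/
  | erm (g : ℕ) (l : List (Fin s × ℕ))
  /-- `r :=` the value of hypothesis `h` on the data point `e`. -/
  | eval (r h : ℕ) (e : Fin s)
  /-- `g := if a ≤ b then h else h'`. -/
  | selectHyp (g a b h h' : ℕ)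

/-- A learner: the number of data points and of uniformly random workers that it draws, and its
program. -/
structure Learner where
  draws : ℕ
  picks : ℕ
  code : List (Instr draws)

/-- Whether an instruction is a task. -/
def Instr.isTask {s : ℕ} : Instr s → Bool
  | .query _ _ _ => true
  | _ => false

/-- The time that an instruction takes. -/
def Instr.cost {s : ℕ} : Instr s → ℕ
  | .const _ v => v + 1
  | .erm _ l => l.length + 1
  | _ => 1

/-- The number of tasks given to workers in every run of the learner. -/
def Learner.tasks (P : Learner) : ℕ := P.code.countP Instr.isTask

/-- The running time: drawing data points and workers, and executing the program. -/
def Learner.time (P : Learner) : ℕ := P.draws + P.picks + (P.code.map Instr.cost).sum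

/-- The registers. -/
structure State (X : Type*) where
  num : ℕ → ℕ
  hyp : ℕ → X → Bool

/-- Write `v` into number register `r`. -/
def State.setNum {X : Type*} (σ : State X) (r v : ℕ) : State X :=
  { σ with num := Function.update σ.num r v }

/-- Write `h` into hypothesis register `g`. -/
def State.setHyp {X : Type*} (σ : State X) (g : ℕ) (h : X → Bool) : State X :=
  { σ with hyp := Function.update σ.hyp g h }

/-- One step of a learner on the data points `z`. -/
def step {X : Type*} {n s : ℕ} (erm : List (X × Bool) → X → Bool) (c : X → Bool)
    (z : Fin s → DataPoint X n) (σ : State X) : Instr s → State X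
  | .const r v => σ.setNum r v
  | .add r a b => σ.setNum r (σ.num a + σ.num b)
  | .select r a b u v => σ.setNum r (if σ.num a ≤ σ.num b then σ.num u else σ.num v)
  | .query r w e =>
      σ.setNum r (if hw : σ.num w < n then (DataPoint.label c (z e) ⟨σ.num w, hw⟩).toNat else 0)
  | .erm g l => σ.setHyp g (erm (l.map fun q => ((z q.1).1, decide (σ.num q.2 ≠ 0))))
  | .eval r h e => σ.setNum r (σ.hyp h (z e).1).toNat
  | .selectHyp g a b h h' => σ.setHyp g (if σ.num a ≤ σ.num b then σ.hyp h else σ.hyp h')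

/-- The random input of a learner: its data points and its random workers. -/
abbrev Learner.Input (P : Learner) (X : Type*) (n : ℕ) : Type _ :=
  (Fin P.draws → DataPoint X n) × (Fin P.picks → Fin n)

/-- The data points are independent with law `dataLaw η D`; the random workers are independent and
uniformly distributed, and independent of the data points. -/
def Learner.inputLaw (P : Learner) {X : Type*} [MeasurableSpace X] {n : ℕ}
    (η : Fin n → Bool → unitInterval) (D : Measure X) : Measure (P.Input X n) :=
  (Measure.pi fun _ => dataLaw η D).prod (Measure.pi fun _ => uniformOn Set.univ)

/-- The hypothesis that the learner returns. At the start, number register `j` holds the `j`-th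
random worker (or `0`) and the hypothesis registers hold the minimiser's concept for the empty
sample; the output is hypothesis register `0` at the end. -/
def Learner.output (P : Learner) {X : Type*} {n : ℕ} (erm : List (X × Bool) → X → Bool)
    (c : X → Bool) (ω : P.Input X n) : X → Bool :=
  (P.code.foldl (step erm c ω.1)
    { num := fun j => if hj : j < P.picks then (ω.2 ⟨j, hj⟩ : ℕ) else 0
      hyp := fun _ => erm [] }).hyp 0

/-! ## The bounds

`M` is a bound on the larger one of the two average error rates of the crowd, `b` on the weighted
error rate of the best worker, and `m` on the larger one of the two error rates of that worker. -/

/-- The task bound, without the factors that `Õ` suppresses. -/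
def taskBound (n d : ℕ) (ε δ M b m : ℝ) : ℝ :=
  Real.log (n / δ) ^ 2 / ((1 - 2 * M) ^ 2 * (1 - 2 * b) ^ 2)
    + (n + d / ε) * (Real.log (1 / δ) / (1 - 2 * m) ^ 2)

/-- The order of the number of ground-truth data points on which the workers are compared. -/
def truthSize (n : ℕ) (δ b : ℝ) : ℝ := Real.log (n / δ) / (1 - 2 * b) ^ 2

end CrowdPAC

end

/-! Each of `T` points is labelled by all `n` workers. By Hoeffding and the crowd-size hypothesis
every majority vote on them is correct with high probability, so the workers can be compared with
the truth.

Let `i` be the best worker and `g ≤ 1 - 2 * weightedError`. The quantities `Pr[c = s] * (1 - 2 * η i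
s)`, over the two labels `s`, sum to at least `g`, so one of them is at least `g / 2`. Scores
estimate these quantities for all pairs (worker, label) up to `g / 8`. Hence some pair passes the
threshold `3 * g / 8`, and every pair `(j, s)` that passes has `1 - 2 * η j s ≥ g / 4`.

The chosen worker may still be useless on examples of label `!s`. Therefore each fresh point enters
the sample `a ≈ 8 / g` times with the label of `j` and once with the constant label `!s`. The
constant costs one unit on label `s`, where `a` copies gain at least two, and gains one unit on
label `!s`, where the rate is at most `1 / 2`. So an error of a hypothesis costs on average at least
`1 / (a + 1)` of normalised excess loss, whatever the true label (`le_integral_excess`).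

The excess loss is bounded by the error indicator and its mean dominates a multiple of the error
probability. Such a margin gives a fast rate: about `(d + log (n / δ)) / (g ^ 2 * ε)` points
suffice, up to logarithms, with `1 / ε` rather than `1 / ε ^ 2` (`FastLearner.measure_error_ge_le`,
by exponential symmetrisation and Sauer's bound).

The straight-line program is verified by loop invariants. `measure_crowdLearner_error_le` is the
union bound over the three ways to fail, and `Params` fixes the numbers. The tasks, `T * n + N`, are
covered by the second summand of `taskBound`. -/

namespace CrowdPAC

/-! ## A fast-rate bound for empirical minimisers -/

/-- The exponent that one pair of a sample point and a ghost point contributes. -/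
noncomputable def ghostTerm (g u v i j : ℝ) : ℝ :=
  g / 8 * ((v - g / 4 * j) - (u - g / 4 * i)) - 2 * (g / 8) ^ 2 * (i + j)

/-- Swapping the two points flips the sign of the linear part `x` and keeps the penalty `y`, so the
sum is `2 * cosh x * exp (-y)`. The penalty is just large enough for `cosh x ≤ exp (x ^ 2 / 2)` to
be absorbed. -/
lemma exp_ghostTerm_add_swap_le {g u v i j : ℝ} (hg0 : 0 ≤ g) (hg1 : g ≤ 1)
    (hi : i = 0 ∨ i = 1) (hj : j = 0 ∨ j = 1) (hu : |u| ≤ i) (hv : |v| ≤ j) :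
    Real.exp (ghostTerm g u v i j) + Real.exp (ghostTerm g v u j i) ≤ 2 := by
  set x := g / 8 * ((v - g / 4 * j) - (u - g / 4 * i)) with hx
  set y := 2 * (g / 8) ^ 2 * (i + j) with hy
  have h1 : ghostTerm g u v i j = x - y := by simp only [ghostTerm, hx, hy]
  have h2 : ghostTerm g v u j i = -x - y := by simp only [ghostTerm, hx, hy]; ring
  have hxy : x ^ 2 / 2 ≤ y := by
    -- Here `5 / 4 ≥ 1 + g / 4`. With `(i + j) ^ 2 ≤ 2 * (i + j)` this gives `x ^ 2 / 2 ≤ 25 / 16 *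
    -- (g / 8) ^ 2 * (i + j)`, below `y` because `25 / 16 ≤ 2`.
    have hd : |(v - g / 4 * j) - (u - g / 4 * i)| ≤ 5 / 4 * (i + j) := by
      rw [abs_le] at *
      have : 0 ≤ i := by rcases hi with h | h <;> simp [h]
      have : 0 ≤ j := by rcases hj with h | h <;> simp [h]
      constructor <;> nlinarith
    have hsq : ((v - g / 4 * j) - (u - g / 4 * i)) ^ 2 ≤ (5 / 4 * (i + j)) ^ 2 :=
      sq_le_sq' (by rw [abs_le] at hd; linarith [hd.1]) (abs_le.1 hd).2
    have hij : (i + j) ^ 2 ≤ 2 * (i + j) := by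
      rcases hi with h | h <;> rcases hj with h' | h' <;> rw [h, h'] <;> norm_num
    have : x ^ 2 = (g / 8) ^ 2 * ((v - g / 4 * j) - (u - g / 4 * i)) ^ 2 := by rw [hx]; ring
    have hg : 0 ≤ (g / 8) ^ 2 := sq_nonneg _
    rw [this, hy]
    nlinarith [mul_le_mul_of_nonneg_left hsq hg, mul_le_mul_of_nonneg_left hij hg,
      mul_nonneg hg (sq_nonneg (i + j))]
  have h3 : Real.exp (x - y) + Real.exp (-x - y) = 2 * (Real.cosh x * Real.exp (-y)) := by
    rw [Real.cosh_eq, sub_eq_add_neg, sub_eq_add_neg, Real.exp_add, Real.exp_add]; ring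
  rw [h1, h2, h3]
  have : Real.cosh x * Real.exp (-y) ≤ 1 := by
    calc Real.cosh x * Real.exp (-y) ≤ Real.exp (x ^ 2 / 2) * Real.exp (-y) :=
          mul_le_mul_of_nonneg_right (Real.cosh_le_exp_half_sq x) (Real.exp_nonneg _)
      _ = Real.exp (x ^ 2 / 2 - y) := by rw [← Real.exp_add, sub_eq_add_neg]
      _ ≤ 1 := Real.exp_le_one_iff.2 (by linarith)
  linarith

/-- Swap the two points of each pair that `τ` selects. -/
def swapPairs {Z : Type*} {N : ℕ} (τ : Fin N → Bool) (w : Fin N → Z × Z) : Fin N → Z × Z :=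
  fun k => if τ k then (w k).swap else w k

lemma measurePreserving_swapPairs {Z : Type*} [MeasurableSpace Z] (μ : Measure Z)
    [IsProbabilityMeasure μ] {N : ℕ} (τ : Fin N → Bool) :
    MeasurePreserving (swapPairs τ) (Measure.pi fun _ : Fin N => μ.prod μ)
      (Measure.pi fun _ : Fin N => μ.prod μ) := by
  refine measurePreserving_pi (fun _ : Fin N => μ.prod μ) (fun _ : Fin N => μ.prod μ)
    (f := fun k p => if τ k then p.swap else p) fun k => ?_
  cases h : τ k
  · simpa [h] using! MeasurePreserving.id (μ.prod μ)
  · simpa [h] using Measure.measurePreserving_swap (μ := μ) (ν := μ)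

/-- For a fixed hypothesis the pairs are swapped independently, so the sum factorises into one
two-term sum per pair, each at most `2`. -/
lemma sum_exp_ghost_swapPairs_le {Z : Type*} {N : ℕ} {g : ℝ} (hg0 : 0 ≤ g) (hg1 : g ≤ 1) {f I : Z → ℝ}
    (hI : ∀ z, I z = 0 ∨ I z = 1) (hf : ∀ z, |f z| ≤ I z) (w : Fin N → Z × Z) :
    ∑ τ : Fin N → Bool, Real.exp (∑ k, ghostTerm g (f (swapPairs τ w k).1) (f (swapPairs τ w k).2)
      (I (swapPairs τ w k).1) (I (swapPairs τ w k).2)) ≤ 2 ^ N := by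
  let F : Fin N → Bool → ℝ := fun k t =>
    Real.exp (ghostTerm g (f (if t then (w k).swap else w k).1) (f (if t then (w k).swap else w k).2)
      (I (if t then (w k).swap else w k).1) (I (if t then (w k).swap else w k).2))
  have h1 : ∀ τ : Fin N → Bool, Real.exp (∑ k, ghostTerm g (f (swapPairs τ w k).1)
      (f (swapPairs τ w k).2) (I (swapPairs τ w k).1) (I (swapPairs τ w k).2)) = ∏ k, F k (τ k) :=
    fun τ => Real.exp_sum _ _
  simp_rw [h1]
  have h2 : ∑ τ : Fin N → Bool, ∏ k, F k (τ k) = ∏ k, ∑ t, F k t := by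
    rw [Finset.prod_univ_sum, Fintype.piFinset_univ]
  rw [h2]
  calc ∏ k, ∑ t, F k t ≤ ∏ _k : Fin N, (2 : ℝ) := by
        refine Finset.prod_le_prod (fun k _ => Finset.sum_nonneg fun t _ => (Real.exp_pos _).le)
          fun k _ => ?_
        rw [Fintype.sum_bool, add_comm]
        simpa [F] using exp_ghostTerm_add_swap_le hg0 hg1 (hI (w k).1) (hI (w k).2) (hf (w k).1)
          (hf (w k).2)
    _ = 2 ^ N := by simp

variable {Z H : Type*} [MeasurableSpace Z]

/-- The data of an empirical minimiser `A` with excess losses `f h` that are supported, and bounded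
by `1`, where `h` errs, and whose mean is at least `g` times the probability that `h` errs. -/
structure FastLearner (μ : Measure Z) (N : ℕ) (g : ℝ) (f I : H → Z → ℝ) (A : (Fin N → Z) → H)
    (G : ℝ) : Prop where
  g_pos : 0 < g
  g_le : g ≤ 1
  ind : ∀ h z, I h z = 0 ∨ I h z = 1
  abs_loss_le : ∀ h z, |f h z| ≤ I h z
  meas : ∀ h, Measurable (f h)
  meas_ind : ∀ h, Measurable (I h)
  meas_joint : Measurable fun p : (Fin N → Z) × Z => f (A p.1) p.2
  meas_ind_joint : Measurable fun p : (Fin N → Z) × Z => I (A p.1) p.2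
  mean : ∀ h, g * ∫ z, I h z ∂μ ≤ ∫ z, f h z ∂μ
  minimal : ∀ S, ∑ k, f (A S) (S k) ≤ 0
  growth : ∀ w : Fin N → Z × Z, ∃ t : Finset H, (t.card : ℝ) ≤ G ∧ ∀ h, ∃ h' ∈ t, ∀ k,
    f h (w k).1 = f h' (w k).1 ∧ f h (w k).2 = f h' (w k).2 ∧
    I h (w k).1 = I h' (w k).1 ∧ I h (w k).2 = I h' (w k).2

namespace FastLearner

variable {μ : Measure Z} {N : ℕ} {g : ℝ} {f I : H → Z → ℝ}
  {A : (Fin N → Z) → H} {G : ℝ}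

lemma ind_nonneg (L : FastLearner μ N g f I A G) (h : H) (z : Z) : 0 ≤ I h z := by
  rcases L.ind h z with e | e <;> simp [e]

lemma ind_le_one (L : FastLearner μ N g f I A G) (h : H) (z : Z) : I h z ≤ 1 := by
  rcases L.ind h z with e | e <;> simp [e]

lemma integrable_ind [IsProbabilityMeasure μ] (L : FastLearner μ N g f I A G) (h : H) : Integrable (I h) μ :=
  Integrable.of_bound (L.meas_ind h).aestronglyMeasurable 1 (ae_of_all _ fun z => by
    rw [Real.norm_eq_abs, abs_of_nonneg (L.ind_nonneg h z)]; exact L.ind_le_one h z)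

lemma integrable_loss [IsProbabilityMeasure μ] (L : FastLearner μ N g f I A G) (h : H) : Integrable (f h) μ :=
  Integrable.of_bound (L.meas h).aestronglyMeasurable 1 (ae_of_all _ fun z =>
    (L.abs_loss_le h z).trans (L.ind_le_one h z))

/-- The exponential moment that is bounded by symmetrisation. -/
noncomputable def ghostExp (g : ℝ) (f I : H → Z → ℝ) (A : (Fin N → Z) → H)
    (p : (Fin N → Z) × (Fin N → Z)) : ℝ :=
  Real.exp (∑ k, ghostTerm g (f (A p.1) (p.1 k)) (f (A p.1) (p.2 k))
    (I (A p.1) (p.1 k)) (I (A p.1) (p.2 k)))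

lemma measurable_ghostExp (L : FastLearner μ N g f I A G) : Measurable (ghostExp g f I A) := by
  have e1 : ∀ k, Measurable fun p : (Fin N → Z) × (Fin N → Z) => (p.1, p.1 k) := fun k => by fun_prop
  have e2 : ∀ k, Measurable fun p : (Fin N → Z) × (Fin N → Z) => (p.1, p.2 k) := fun k => by fun_prop
  have a1 := fun k => L.meas_joint.comp (e1 k)
  have a2 := fun k => L.meas_joint.comp (e2 k)
  have a3 := fun k => L.meas_ind_joint.comp (e1 k)
  have a4 := fun k => L.meas_ind_joint.comp (e2 k)
  simp only [Function.comp_def] at a1 a2 a3 a4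
  unfold ghostExp ghostTerm
  refine Real.measurable_exp.comp (Finset.measurable_sum _ fun k _ => ?_)
  exact ((((a2 k).sub ((a4 k).const_mul _)).sub ((a1 k).sub ((a3 k).const_mul _))).const_mul _).sub
    (((a3 k).add (a4 k)).const_mul _)

/-- A crude bound, needed only for integrability. -/
lemma ghostTerm_le (L : FastLearner μ N g f I A G) (h : H) (z z' : Z) :
    ghostTerm g (f h z) (f h z') (I h z) (I h z') ≤ 2 := by
  have h1 := exp_ghostTerm_add_swap_le L.g_pos.le L.g_le (L.ind h z) (L.ind h z') (L.abs_loss_le h z)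
    (L.abs_loss_le h z')
  have h2 := Real.add_one_le_exp (ghostTerm g (f h z) (f h z') (I h z) (I h z'))
  have h3 := Real.exp_pos (ghostTerm g (f h z') (f h z) (I h z') (I h z))
  linarith

lemma integrable_ghostExp (L : FastLearner μ N g f I A G)
    (ν : Measure ((Fin N → Z) × (Fin N → Z))) [IsFiniteMeasure ν] :
    Integrable (ghostExp g f I A) ν := by
  refine Integrable.of_bound L.measurable_ghostExp.aestronglyMeasurable (Real.exp (∑ _k : Fin N, 2))
    (ae_of_all _ fun p => ?_)
  rw [ghostExp, Real.norm_eq_abs, Real.abs_exp]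
  exact Real.exp_le_exp.2 (Finset.sum_le_sum fun k _ => L.ghostTerm_le _ _ _)

/-- Symmetrisation: the law of the pairs is invariant under every swap `τ`, so the integral equals
its average over `τ`. Pointwise this average is at most `G`, one unit for each behaviour on the `2 *
N` points. -/
lemma integral_ghostExp_le [IsProbabilityMeasure μ] (L : FastLearner μ N g f I A G) :
    ∫ p, ghostExp g f I A p ∂((Measure.pi fun _ => μ).prod (Measure.pi fun _ => μ)) ≤ G := by
  have hmp := measurePreserving_arrowProdEquivProdArrow Z Z (Fin N) (fun _ => μ) (fun _ => μ)
  rw [← hmp.integral_comp']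
  set ν := Measure.pi fun _ : Fin N => μ.prod μ
  set F : (Fin N → Z × Z) → ℝ := fun w =>
    ghostExp g f I A (MeasurableEquiv.arrowProdEquivProdArrow Z Z (Fin N) w) with hF
  have hFi : Integrable F ν := (hmp.integrable_comp_emb (MeasurableEquiv.measurableEmbedding _)).2
    (L.integrable_ghostExp _)
  have hFs : ∀ τ, Integrable (fun w => F (swapPairs τ w)) ν := fun τ =>
    (measurePreserving_swapPairs μ τ).integrable_comp_of_integrable hFi
  have hinv : ∀ τ, ∫ w, F (swapPairs τ w) ∂ν = ∫ w, F w ∂ν := fun τ => by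
    have h : MeasurePreserving (swapPairs τ) ν ν := measurePreserving_swapPairs μ τ
    conv_rhs => rw [← h.map_eq]
    exact (integral_map h.measurable.aemeasurable (by rw [h.map_eq]; exact hFi.1)).symm
  have hpt : ∀ w, ∑ τ, F (swapPairs τ w) ≤ G * 2 ^ N := fun w => by
    obtain ⟨t, ht, hcov⟩ := L.growth w
    have hle : ∀ τ, F (swapPairs τ w) ≤ ∑ h ∈ t, Real.exp (∑ k, ghostTerm g
        (f h (swapPairs τ w k).1) (f h (swapPairs τ w k).2)
        (I h (swapPairs τ w k).1) (I h (swapPairs τ w k).2)) := fun τ => by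
      -- The learned hypothesis varies with `τ`. Its representative lies in `t`, which does not
      -- depend on `τ`; summing over all of `t` removes the dependence.
      obtain ⟨h', hh', e⟩ := hcov (A fun k => (swapPairs τ w k).1)
      refine le_trans (le_of_eq ?_) (Finset.single_le_sum
        (f := fun h => Real.exp (∑ k, ghostTerm g
        (f h (swapPairs τ w k).1) (f h (swapPairs τ w k).2)
        (I h (swapPairs τ w k).1) (I h (swapPairs τ w k).2))) (fun _ _ => (Real.exp_pos _).le) hh')
      simp only [hF, ghostExp, MeasurableEquiv.arrowProdEquivProdArrow, Equiv.arrowProdEquivProdArrow,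
        MeasurableEquiv.coe_mk, Equiv.coe_fn_mk]
      congr 1
      refine Finset.sum_congr rfl fun k _ => ?_
      generalize (A fun k => (swapPairs τ w k).1) = h at e
      obtain ⟨e1, e2, e3, e4⟩ := e k
      unfold swapPairs
      cases τ k <;> simp [e1, e2, e3, e4]
    calc ∑ τ, F (swapPairs τ w) ≤ ∑ τ : Fin N → Bool, ∑ h ∈ t, Real.exp (∑ k, ghostTerm g
        (f h (swapPairs τ w k).1) (f h (swapPairs τ w k).2)
        (I h (swapPairs τ w k).1) (I h (swapPairs τ w k).2)) := Finset.sum_le_sum fun τ _ => hle τ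
      _ ≤ ∑ h ∈ t, (2 : ℝ) ^ N := by
        rw [Finset.sum_comm]
        exact Finset.sum_le_sum fun h _ => sum_exp_ghost_swapPairs_le L.g_pos.le L.g_le (L.ind h)
          (L.abs_loss_le h) w
      _ ≤ G * 2 ^ N := by
        rw [Finset.sum_const, nsmul_eq_mul]; gcongr
  have h2 : (2 : ℝ) ^ N * ∫ w, F w ∂ν ≤ 2 ^ N * G := by
    calc (2 : ℝ) ^ N * ∫ w, F w ∂ν = ∑ τ : Fin N → Bool, ∫ w, F (swapPairs τ w) ∂ν := by
          simp [hinv]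
      _ = ∫ w, ∑ τ : Fin N → Bool, F (swapPairs τ w) ∂ν := (integral_finsetSum _ fun τ _ => hFs τ).symm
      _ ≤ ∫ _w, G * 2 ^ N ∂ν := integral_mono (integrable_finsetSum _ fun τ _ => hFs τ)
          (integrable_const _) hpt
      _ = 2 ^ N * G := by simp [mul_comm]
  exact le_of_mul_le_mul_left h2 (by positivity)

/-- Jensen's inequality in the ghost sample replaces the ghost losses by their means. What remains
is bounded below using `minimal` and `mean`. -/
lemma le_integral_ghost [IsProbabilityMeasure μ] (L : FastLearner μ N g f I A G) (S : Fin N → Z) :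
    Real.exp (N * (g ^ 2 / 16) * ∫ z, I (A S) z ∂μ) ≤
      ∫ S', ghostExp g f I A (S, S') ∂(Measure.pi fun _ => μ) := by
  set h := A S with hh
  have hi : ∀ k, Integrable (fun z => ghostTerm g (f h (S k)) (f h z) (I h (S k)) (I h z)) μ := fun k =>
    ((((L.integrable_loss h).sub ((L.integrable_ind h).const_mul _)).sub
      (integrable_const _)).const_mul _).sub (((integrable_const _).add (L.integrable_ind h)).const_mul _)
  have hk : ∀ k, ∫ z, ghostTerm g (f h (S k)) (f h z) (I h (S k)) (I h z) ∂μ =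
      ghostTerm g (f h (S k)) (∫ z, f h z ∂μ) (I h (S k)) (∫ z, I h z ∂μ) := fun k => by
    unfold ghostTerm
    have i1 := L.integrable_loss h
    have i2 := L.integrable_ind h
    rw [integral_sub, integral_const_mul, integral_const_mul, integral_sub, integral_sub,
      integral_const_mul, integral_add]
    · simp
    all_goals fun_prop
  have hip : ∀ k, Integrable (fun S' : Fin N → Z =>
      ghostTerm g (f h (S k)) (f h (S' k)) (I h (S k)) (I h (S' k))) (Measure.pi fun _ => μ) := fun k =>
    (measurePreserving_eval (fun _ : Fin N => μ) k).integrable_comp_of_integrable (hi k)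
  have hJ := (convexOn_exp).map_integral_le (μ := Measure.pi fun _ : Fin N => μ)
    (f := fun S' => ∑ k, ghostTerm g (f h (S k)) (f h (S' k)) (I h (S k)) (I h (S' k)))
    Real.continuous_exp.continuousOn isClosed_univ (by simp)
    (integrable_finsetSum _ fun k _ => hip k) ?_
  · refine le_trans (Real.exp_le_exp.2 ?_) hJ
    rw [integral_finsetSum _ fun k _ => hip k]
    have : ∀ k, ∫ S' : Fin N → Z, ghostTerm g (f h (S k)) (f h (S' k)) (I h (S k)) (I h (S' k))
        ∂(Measure.pi fun _ => μ) =
        ghostTerm g (f h (S k)) (∫ z, f h z ∂μ) (I h (S k)) (∫ z, I h z ∂μ) := fun k => by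
      rw [← hk k]
      exact integral_comp_eval (μ := fun _ : Fin N => μ) (i := k) (hi k).aestronglyMeasurable
    simp_rw [this]
    have hmin := L.minimal S
    have hmean := L.mean h
    rw [← hh] at hmin
    -- The offset `g / 4` makes the empirical indicator cancel: `g / 8 * (g / 4) = 2 * (g / 8) ^ 2`.
    -- The mean indicator keeps the coefficient `3 * g ^ 2 / 32 - g ^ 2 / 32 = g ^ 2 / 16`.
    have hlow : ∀ k, g / 8 * (g - g / 4) * (∫ z, I h z ∂μ) - 2 * (g / 8) ^ 2 * (∫ z, I h z ∂μ)
        - g / 8 * f h (S k) ≤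
        ghostTerm g (f h (S k)) (∫ z, f h z ∂μ) (I h (S k)) (∫ z, I h z ∂μ) := fun k => by
      unfold ghostTerm
      have := L.g_pos
      nlinarith
    refine le_trans ?_ (Finset.sum_le_sum fun k _ => hlow k)
    rw [Finset.sum_sub_distrib, ← Finset.mul_sum, Finset.sum_const, Finset.card_univ, Fintype.card_fin,
      nsmul_eq_mul]
    have := L.g_pos
    nlinarith
  · refine Integrable.of_bound (C := Real.exp (∑ _k : Fin N, 2)) ?_ (ae_of_all _ fun p => ?_)
    · exact (L.measurable_ghostExp.comp measurable_prodMk_left).aestronglyMeasurable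
    · simp only [Function.comp, Real.norm_eq_abs, Real.abs_exp]
      exact Real.exp_le_exp.2 (Finset.sum_le_sum fun k _ => L.ghostTerm_le _ _ _)

/-- The empirical minimiser errs with probability `ε` or more only with exponentially small
probability. -/
theorem measure_error_ge_le [IsProbabilityMeasure μ] (L : FastLearner μ N g f I A G) (ε : ℝ) :
    (Measure.pi fun _ : Fin N => μ).real {S | ε ≤ ∫ z, I (A S) z ∂μ} ≤
      G * Real.exp (-(N * (g ^ 2 / 16) * ε)) := by
  set P := Measure.pi fun _ : Fin N => μ
  have hsub : {S | ε ≤ ∫ z, I (A S) z ∂μ} ⊆ {S | Real.exp (N * (g ^ 2 / 16) * ε) ≤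
      ∫ S', ghostExp g f I A (S, S') ∂P} := fun S hS =>
    le_trans (Real.exp_le_exp.2 (mul_le_mul_of_nonneg_left hS (by positivity))) (L.le_integral_ghost S)
  -- Markov's inequality for the exponential moment conditioned on the sample.
  have hM := mul_meas_ge_le_integral_of_nonneg (μ := P)
    (f := fun S => ∫ S', ghostExp g f I A (S, S') ∂P)
    (ae_of_all _ fun S => integral_nonneg fun S' => (Real.exp_pos _).le)
    (L.integrable_ghostExp (P.prod P)).integral_prod_left (Real.exp (N * (g ^ 2 / 16) * ε))
  rw [← integral_prod _ (L.integrable_ghostExp (P.prod P))] at hM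
  have h1 := hM.trans L.integral_ghostExp_le
  have h2 := measureReal_mono (μ := P) hsub
  rw [Real.exp_neg, ← div_eq_mul_inv, le_div_iff₀ (Real.exp_pos _), mul_comm]
  exact (mul_le_mul_of_nonneg_left h2 (Real.exp_pos _).le).trans h1

end FastLearner

end CrowdPAC

namespace CrowdPAC

/-! ## Sauer's bound -/

lemma sum_choose_le_pow (m d : ℕ) : ∑ k ∈ Finset.Iic d, m.choose k ≤ (m + 1) ^ d := by
  rw [add_pow, ← Nat.range_succ_eq_Iic]
  refine Finset.sum_le_sum fun k hk => ?_
  have hk' : k ≤ d := by simpa [Nat.lt_succ_iff] using hk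
  rw [one_pow, mul_one]
  exact (Nat.choose_le_pow m k).trans (Nat.le_mul_of_pos_right _ (Nat.choose_pos hk'))

lemma Shatters.card_le {X : Type*} {C : Set (X → Bool)} {d : ℕ} (hC : vcDim C ≤ d) {B : Finset X}
    (hB : Shatters C B) : B.card ≤ d := by
  have h : (B.card : ℕ∞) ≤ vcDim C := le_iSup₂ (f := fun (A : Finset X) (_ : Shatters C A) =>
    (A.card : ℕ∞)) B hB
  exact_mod_cast h.trans hC

open Classical in
/-- Concepts from a class of VC dimension at most `d` label `m` points in at most `(m + 1) ^ d`
ways. -/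
lemma exists_finset_cover {X ι : Type*} [Fintype ι] {C : Set (X → Bool)} {d : ℕ}
    (hC : vcDim C ≤ d) (p : ι → X) :
    ∃ t : Finset C, t.card ≤ (Fintype.card ι + 1) ^ d ∧
      ∀ h : C, ∃ h' ∈ t, ∀ i, h.1 (p i) = h'.1 (p i) := by
  set B : Finset X := Finset.univ.image p
  set tr : C → Finset B := fun h => Finset.univ.filter fun x => h.1 x = true with htr
  set 𝒜 : Finset (Finset B) := Finset.univ.filter fun u => ∃ h, tr h = u with h𝒜
  have hcard : 𝒜.card ≤ (Fintype.card ι + 1) ^ d := by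
    have hvc : 𝒜.vcDim ≤ d := by
      refine Finset.sup_le fun u hu => ?_
      rw [Finset.mem_shatterer] at hu
      -- A set shattered by the traces is shattered by `C` itself, so the Sauer–Shelah inequality
      -- for finite set families applies with the bound `d`.
      have hsh : Shatters C (u.map (Function.Embedding.subtype _)) := fun t => by
        obtain ⟨v, hv, hvu⟩ := hu (Finset.filter_subset (fun x => t x.1 = true) u)
        obtain ⟨h, rfl⟩ := (Finset.mem_filter.1 hv).2
        refine ⟨h.1, h.2, fun x hx => ?_⟩
        obtain ⟨y, hy, rfl⟩ := Finset.mem_map.1 hx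
        have hm := congrArg (y ∈ ·) hvu
        simp only [Finset.mem_inter, hy, true_and, htr, Finset.mem_filter, Finset.mem_univ,
          eq_iff_iff] at hm
        simpa using Bool.eq_iff_iff.2 hm
      simpa using hsh.card_le hC
    have hB : B.card ≤ Fintype.card ι := Finset.card_image_le.trans (by simp)
    calc 𝒜.card ≤ 𝒜.shatterer.card := Finset.card_le_card_shatterer 𝒜
      _ ≤ ∑ k ∈ Finset.Iic 𝒜.vcDim, (Fintype.card B).choose k := Finset.card_shatterer_le_sum_vcDim
      _ ≤ (B.card + 1) ^ 𝒜.vcDim := by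
        simpa using sum_choose_le_pow B.card 𝒜.vcDim
      _ ≤ (Fintype.card ι + 1) ^ d :=
        (Nat.pow_le_pow_left (by omega) _).trans (Nat.pow_le_pow_right (by omega) hvc)
  have hpre : ∀ u ∈ 𝒜, ∃ h, tr h = u := fun u hu => (Finset.mem_filter.1 hu).2
  refine ⟨𝒜.attach.image fun u => (hpre u.1 u.2).choose,
    Finset.card_image_le.trans (by simpa using hcard), fun h => ?_⟩
  have hu : tr h ∈ 𝒜 := Finset.mem_filter.2 ⟨Finset.mem_univ _, h, rfl⟩
  refine ⟨_, Finset.mem_image_of_mem _ (Finset.mem_attach _ ⟨tr h, hu⟩), fun i => ?_⟩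
  have hs := (hpre _ hu).choose_spec
  have hm := congrArg ((⟨p i, Finset.mem_image_of_mem p (Finset.mem_univ i)⟩ : B) ∈ ·) hs
  simp only [htr, Finset.mem_filter, Finset.mem_univ, true_and, eq_iff_iff] at hm
  exact Bool.eq_iff_iff.2 hm.symm

/-! ## The law of a data point -/

section Law

variable {X : Type*} [MeasurableSpace X] {n : ℕ} (η : Fin n → Bool → unitInterval) (D : Measure X)
  [IsProbabilityMeasure D]

instance : IsProbabilityMeasure (dataLaw η D) := by unfold dataLaw; infer_instance

lemma integral_noise (j : Fin n) (l : Bool) (ψ : Bool → ℝ) :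
    ∫ u, ψ (u j l) ∂(Measure.pi fun i => Measure.pi fun b => bernoulliMeasure true false (η i b)) =
      η j l * ψ true + (1 - η j l) * ψ false := by
  have hm : Measurable ψ := measurable_of_countable _
  rw [integral_comp_eval (μ := fun i => Measure.pi fun b => bernoulliMeasure true false (η i b))
    (i := j) (f := fun v : Bool → Bool => ψ (v l))
    (hm.comp (measurable_pi_apply l)).aestronglyMeasurable,
    integral_comp_eval (μ := fun b => bernoulliMeasure true false (η j b)) (i := l) (f := ψ)
    hm.aestronglyMeasurable, integral_bernoulliMeasure]
  simp

lemma integral_dataLaw_mul (φ : X → ℝ) (j : Fin n) (l : Bool) (ψ : Bool → ℝ) :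
    ∫ z, φ z.1 * ψ (z.2 j l) ∂(dataLaw η D) =
      (∫ x, φ x ∂D) * (η j l * ψ true + (1 - η j l) * ψ false) := by
  rw [← integral_noise η j l ψ]
  exact integral_prod_mul φ (fun u : Fin n → Bool → Bool => ψ (u j l))

lemma integral_dataLaw_fst (φ : X → ℝ) : ∫ z, φ z.1 ∂(dataLaw η D) = ∫ x, φ x ∂D := by
  rw [dataLaw, integral_fun_fst]; simp

/-- The noise bit that is read depends on the example through `c`; both candidate bits are
measurable, and `c` selects between them. -/
lemma measurable_noise {c : X → Bool} (hc : Measurable c) (j : Fin n) :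
    Measurable fun z : DataPoint X n => z.2 j (c z.1) := by
  have h : (fun z : DataPoint X n => z.2 j (c z.1)) =
      fun z => bif c z.1 then z.2 j true else z.2 j false := by
    ext z; cases c z.1 <;> rfl
  rw [h]
  have : Measurable fun q : Bool × Bool × Bool => bif q.1 then q.2.1 else q.2.2 :=
    measurable_of_countable _
  have e : ∀ b, Measurable fun z : DataPoint X n => z.2 j b := fun b => by fun_prop
  exact this.comp ((hc.comp measurable_fst).prodMk ((e true).prodMk (e false)))

lemma measurable_label {c : X → Bool} (hc : Measurable c) (j : Fin n) :
    Measurable fun z : DataPoint X n => DataPoint.label c z j := by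
  have : Measurable fun q : Bool × Bool => xor q.1 q.2 := measurable_of_countable _
  exact this.comp ((hc.comp measurable_fst).prodMk (measurable_noise hc j))

end Law

/-! ## Learning from one worker

Each data point enters the sample `a` times with the label of the worker and once with the label
`!s`. This compensates that the worker may be uninformative on examples of label `!s`. -/

section Padded

variable {X : Type*} {n : ℕ}

/-- The entries of the padded sample: the data point, and whether it carries the worker's label. -/
def paddedIndex (N a : ℕ) : List (Fin N × Bool) :=
  (List.finRange N).flatMap fun k => List.replicate a (k, true) ++ [(k, false)]

/-- An entry of the padded sample. -/
def paddedEntry (c : X → Bool) (j : Fin n) (s : Bool) {N : ℕ} (S : Fin N → DataPoint X n)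
    (q : Fin N × Bool) : X × Bool :=
  ((S q.1).1, bif q.2 then DataPoint.label c (S q.1) j else !s)

/-- The padded sample. -/
def paddedSample (c : X → Bool) (j : Fin n) (s : Bool) (a : ℕ) {N : ℕ} (S : Fin N → DataPoint X n) :
    List (X × Bool) :=
  (paddedIndex N a).map (paddedEntry c j s S)

/-- The indicator of an error of `h`. -/
noncomputable def errInd (c h : X → Bool) (z : DataPoint X n) : ℝ := if h z.1 = c z.1 then 0 else 1

/-- The normalised excess loss of `h` on the padded copies of a data point. -/
noncomputable def excess (c : X → Bool) (j : Fin n) (s : Bool) (a : ℕ) (h : X → Bool) (z : DataPoint X n) : ℝ :=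
  errInd c h z * ((a * (if z.2 j (c z.1) then -1 else 1) + if c z.1 = s then -1 else 1) / (a + 1))

lemma disagreements_paddedSample (c : X → Bool) (j : Fin n) (s : Bool) (a : ℕ) {N : ℕ}
    (S : Fin N → DataPoint X n) (h : X → Bool) :
    (disagreements h (paddedSample c j s a S) : ℝ) = ∑ k,
      ((a : ℝ) * (if h (S k).1 = DataPoint.label c (S k) j then 0 else 1) +
        if h (S k).1 = !s then 0 else 1) := by
  unfold disagreements paddedSample paddedIndex
  rw [List.countP_map, List.countP_flatMap]
  rw [show (∑ k, ((a : ℝ) * (if h (S k).1 = DataPoint.label c (S k) j then 0 else 1) +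
        if h (S k).1 = !s then 0 else 1)) = ((List.finRange N).map fun k =>
        ((a : ℝ) * (if h (S k).1 = DataPoint.label c (S k) j then 0 else 1) +
        if h (S k).1 = !s then 0 else 1)).sum by
      rw [← List.ofFn_eq_map, List.sum_ofFn], Nat.cast_list_sum, List.map_map]
  congr 1
  refine List.map_congr_left fun k _ => ?_
  simp only [Function.comp, List.countP_append, List.countP_replicate, List.countP_singleton,
    paddedEntry, cond_true, cond_false, bne_iff_ne]
  split_ifs <;> simp_all

/-- The sum of the excess losses is the difference of the disagreements of `h` and of `c`, divided
by `a + 1`. -/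
lemma sum_excess_nonpos {c : X → Bool} {j : Fin n} {s : Bool} {a : ℕ} {N : ℕ}
    {S : Fin N → DataPoint X n} {h : X → Bool}
    (hle : disagreements h (paddedSample c j s a S) ≤ disagreements c (paddedSample c j s a S)) :
    ∑ k, excess c j s a h (S k) ≤ 0 := by
  have h1 : (disagreements h (paddedSample c j s a S) : ℝ) ≤
      disagreements c (paddedSample c j s a S) := by exact_mod_cast hle
  rw [disagreements_paddedSample, disagreements_paddedSample, ← sub_nonpos,
    ← Finset.sum_sub_distrib] at h1
  have ha : (0 : ℝ) < a + 1 := by positivity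
  have : ∑ k, excess c j s a h (S k) = (∑ k, (((a : ℝ) *
      (if h (S k).1 = DataPoint.label c (S k) j then 0 else 1) + if h (S k).1 = !s then 0 else 1) -
      ((a : ℝ) * (if c (S k).1 = DataPoint.label c (S k) j then 0 else 1) +
        if c (S k).1 = !s then 0 else 1))) / (a + 1) := by
    rw [Finset.sum_div]
    refine Finset.sum_congr rfl fun k _ => ?_
    unfold excess errInd DataPoint.label
    cases h (S k).1 <;> cases c (S k).1 <;> cases hz : (S k).2 j _ <;> cases s <;> simp <;> ring
  rw [this]
  exact div_nonpos_of_nonpos_of_nonneg h1 ha.le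

lemma abs_excess_le (c : X → Bool) (j : Fin n) (s : Bool) (a : ℕ) (h : X → Bool)
    (z : DataPoint X n) : |excess c j s a h z| ≤ errInd c h z := by
  have ha : (0 : ℝ) < a + 1 := by positivity
  have ha' : (0 : ℝ) ≤ a := by positivity
  unfold excess errInd
  split_ifs <;> simp only [zero_mul, one_mul, abs_zero, le_refl] <;>
    rw [abs_le, le_div_iff₀ ha, div_le_iff₀ ha] <;> constructor <;> linarith

variable [MeasurableSpace X]

lemma measurable_errInd {Ω : Type*} [MeasurableSpace Ω] {u v : Ω → Bool} (hu : Measurable u)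
    (hv : Measurable v) : Measurable fun ω => if u ω = v ω then (0 : ℝ) else 1 :=
  (measurable_of_countable fun q : Bool × Bool => if q.1 = q.2 then (0 : ℝ) else 1).comp
    (hu.prodMk hv)

lemma measurable_excess {Ω : Type*} [MeasurableSpace Ω] {c : X → Bool} (hc : Measurable c)
    (j : Fin n) (s : Bool) (a : ℕ) {H : Ω → X → Bool} {Z : Ω → DataPoint X n} (hZ : Measurable Z)
    (hH : Measurable fun ω => H ω (Z ω).1) : Measurable fun ω => excess c j s a (H ω) (Z ω) := by
  have hc' : Measurable fun ω => c (Z ω).1 := hc.comp (measurable_fst.comp hZ)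
  refine (measurable_errInd hH hc').mul ?_
  exact (measurable_of_countable fun q : Bool × Bool =>
    (((a : ℝ) * (if q.1 then -1 else 1) + if q.2 = s then -1 else 1) / (a + 1))).comp
    (((measurable_noise hc j).comp hZ).prodMk hc')

/-- The padded sample has a fixed length, so it can be written as a `List.ofFn` and the joint
measurability of the minimiser applies. -/
lemma measurable_erm_paddedSample {C : Set (X → Bool)} {erm : List (X × Bool) → X → Bool}
    (hE : IsMinimizer C erm) {c : X → Bool} (hc : Measurable c) (j : Fin n) (s : Bool) (a N : ℕ) :
    Measurable fun p : (Fin N → DataPoint X n) × X => erm (paddedSample c j s a p.1) p.2 := by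
  set l := paddedIndex N a
  have h1 : ∀ S : Fin N → DataPoint X n, paddedSample c j s a S =
      List.ofFn fun i : Fin l.length => paddedEntry c j s S (l.get i) := fun S => by
    rw [paddedSample, ← List.ofFn_get (paddedIndex N a), List.map_ofFn]
    simp [Function.comp_def, l]
  simp_rw [h1]
  refine (hE.measurable l.length).comp (f := fun p : (Fin N → DataPoint X n) × X =>
    ((fun i : Fin l.length => paddedEntry c j s p.1 (l.get i)), p.2)) ?_
  refine Measurable.prodMk (measurable_pi_lambda _ fun i => ?_) measurable_snd
  unfold paddedEntry
  refine Measurable.prodMk (by fun_prop) ?_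
  cases (l.get i).2
  · exact measurable_const
  · exact (measurable_label hc j).comp (by fun_prop)

variable {η : Fin n → Bool → unitInterval} {D : Measure X} [IsProbabilityMeasure D]

lemma integral_errInd {c h : X → Bool} (hc : Measurable c) (hh : Measurable h) :
    ∫ z, errInd c h z ∂(dataLaw η D) = D.real {x | h x ≠ c x} := by
  have hm : MeasurableSet {x | h x ≠ c x} := by
    have := (measurableSet_eq_fun hh hc).compl
    simpa [Set.compl_def] using this
  have : ∀ x, (if h x = c x then (0 : ℝ) else 1) = {x | h x ≠ c x}.indicator 1 x := fun x => by
    by_cases e : h x = c x <;> simp [e, Set.indicator]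
  simp only [errInd]
  rw [integral_dataLaw_fst η D fun x => if h x = c x then (0 : ℝ) else 1]
  simp_rw [this]
  rw [integral_indicator_one hm]

/-- The errors are split by the true label `l`. The noise is independent of the example, so the
conditional mean excess is `a * (1 - 2 * η j l)` minus one if `l = s` and plus one otherwise, over
`a + 1`. The numerator is at least `1` in both cases. -/
lemma le_integral_excess {c h : X → Bool} (hc : Measurable c) (hh : Measurable h) {j : Fin n}
    {s : Bool} {a : ℕ} (hη : ∀ l, (η j l : ℝ) ≤ 1 / 2) (ha : 2 ≤ a * (1 - 2 * (η j s : ℝ))) :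
    1 / ((a : ℝ) + 1) * ∫ z, errInd c h z ∂(dataLaw η D) ≤
      ∫ z, excess c j s a h z ∂(dataLaw η D) := by
  have ha1 : (0 : ℝ) < a + 1 := by positivity
  let φ : Bool → X → ℝ := fun l x => if h x = c x then 0 else if c x = l then 1 else 0
  let ψ : Bool → Bool → ℝ := fun l e =>
    (a * (if e then -1 else 1) + if l = s then -1 else 1) / (a + 1)
  have hφm : ∀ l, Measurable (φ l) := fun l =>
    (measurable_of_countable fun q : Bool × Bool =>
      if q.1 = q.2 then (0 : ℝ) else if q.2 = l then 1 else 0).comp (hh.prodMk hc)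
  have hφ0 : ∀ l x, 0 ≤ φ l x := fun l x => by simp only [φ]; split_ifs <;> norm_num
  have hφ1 : ∀ l x, φ l x ≤ 1 := fun l x => by simp only [φ]; split_ifs <;> norm_num
  have hφi : ∀ l, Integrable (φ l) D := fun l =>
    Integrable.of_bound (hφm l).aestronglyMeasurable 1 (ae_of_all _ fun x => by
      rw [Real.norm_eq_abs, abs_of_nonneg (hφ0 l x)]; exact hφ1 l x)
  have hψi : ∀ l, Integrable (fun u : Fin n → Bool → Bool => ψ l (u j l))
      (Measure.pi fun i => Measure.pi fun b => bernoulliMeasure true false (η i b)) := fun l =>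
    Integrable.of_finite
  have e1 : ∀ z : DataPoint X n, excess c j s a h z = ∑ l, φ l z.1 * ψ l (z.2 j l) := fun z => by
    rw [Fintype.sum_bool]
    simp only [excess, errInd, φ, ψ]
    cases hcz : c z.1 <;> cases h z.1 <;> simp
  have e2 : ∀ z : DataPoint X n, errInd c h z = ∑ l, φ l z.1 := fun z => by
    rw [Fintype.sum_bool]
    simp only [errInd, φ]
    cases hcz : c z.1 <;> cases h z.1 <;> simp
  simp_rw [e1, e2]
  have i1 : ∫ z : DataPoint X n, ∑ l, φ l z.1 * ψ l (z.2 j l) ∂(dataLaw η D) =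
      ∑ l, ∫ z : DataPoint X n, φ l z.1 * ψ l (z.2 j l) ∂(dataLaw η D) :=
    integral_finsetSum _ fun l _ => (hφi l).mul_prod (hψi l)
  have i2 : ∫ z : DataPoint X n, ∑ l, φ l z.1 ∂(dataLaw η D) =
      ∑ l, ∫ z : DataPoint X n, φ l z.1 ∂(dataLaw η D) :=
    integral_finsetSum _ fun l _ => (hφi l).comp_fst _
  rw [i1, i2, Finset.mul_sum]
  refine Finset.sum_le_sum fun l _ => ?_
  rw [integral_dataLaw_mul, integral_dataLaw_fst, mul_comm]
  refine mul_le_mul_of_nonneg_left ?_ (integral_nonneg (hφ0 l))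
  simp only [ψ, if_true, Bool.false_eq_true, if_false]
  rw [mul_div_assoc', mul_div_assoc', ← add_div]
  refine div_le_div_of_nonneg_right ?_ ha1.le
  have := hη l
  have ha0 : (0 : ℝ) ≤ a := by positivity
  by_cases hl : l = s
  · subst hl; simp only [if_true]; nlinarith
  · simp only [hl, if_false]; nlinarith

/-- Learning from a worker that is informative on the examples of label `s`. -/
theorem measure_paddedSample_error_le {C : Set (X → Bool)} {d : ℕ}
    (hCm : ∀ h ∈ C, Measurable h) (hC : vcDim C ≤ d) {erm : List (X × Bool) → X → Bool}
    (hE : IsMinimizer C erm) {c : X → Bool} (hc : c ∈ C) {j : Fin n} {s : Bool} {a : ℕ}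
    (hη : ∀ l, (η j l : ℝ) ≤ 1 / 2) (ha : 2 ≤ a * (1 - 2 * (η j s : ℝ))) (N : ℕ) (ε : ℝ) :
    (Measure.pi fun _ : Fin N => dataLaw η D).real
        {S | ε ≤ D.real {x | erm (paddedSample c j s a S) x ≠ c x}} ≤
      (2 * N + 1) ^ d * Real.exp (-(N * ((1 / ((a : ℝ) + 1)) ^ 2 / 16) * ε)) := by
  have hcm := hCm c hc
  have hjoint : Measurable fun p : (Fin N → DataPoint X n) × DataPoint X n =>
      erm (paddedSample c j s a p.1) p.2.1 :=
    (measurable_erm_paddedSample hE hcm j s a N).comp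
      (f := fun p : (Fin N → DataPoint X n) × DataPoint X n => (p.1, p.2.1)) (by fun_prop)
  have L : FastLearner (H := C) (dataLaw η D) N (1 / ((a : ℝ) + 1))
      (fun h => excess c j s a h.1) (fun h => errInd c h.1)
      (fun S => ⟨erm (paddedSample c j s a S), hE.mem _⟩) ((2 * N + 1) ^ d) :=
    { g_pos := by positivity
      g_le := by rw [div_le_one (by positivity)]; linarith [(a.cast_nonneg : (0 : ℝ) ≤ a)]
      ind := fun h z => by unfold errInd; split_ifs <;> simp
      abs_loss_le := fun h z => abs_excess_le c j s a h.1 z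
      meas := fun h => measurable_excess hcm j s a measurable_id
        ((hCm h.1 h.2).comp measurable_fst)
      meas_ind := fun h => measurable_errInd ((hCm h.1 h.2).comp measurable_fst)
        (hcm.comp measurable_fst)
      meas_joint := measurable_excess hcm j s a measurable_snd hjoint
      meas_ind_joint := measurable_errInd hjoint (hcm.comp (measurable_fst.comp measurable_snd))
      mean := fun h => le_integral_excess hcm (hCm h.1 h.2) hη ha
      minimal := fun S => sum_excess_nonpos (hE.le _ c hc)
      growth := fun w => by
        obtain ⟨t, ht, hcov⟩ := exists_finset_cover hC
          -- Losses and error indicators depend on the hypothesis only through its values at the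
          -- sample and ghost points, so Sauer's bound is applied to `2 * N` points.
          (fun i : Fin N ⊕ Fin N => Sum.elim (fun k => (w k).1.1) (fun k => (w k).2.1) i)
        refine ⟨t, ?_, fun h => ?_⟩
        · have : ((t.card : ℕ) : ℝ) ≤ (((Fintype.card (Fin N ⊕ Fin N) + 1) ^ d : ℕ) : ℝ) := by
            exact_mod_cast ht
          refine this.trans (le_of_eq ?_)
          simp [two_mul]
        · obtain ⟨h', hh', e⟩ := hcov h
          refine ⟨h', hh', fun k => ?_⟩
          have e1 : h.1 (w k).1.1 = h'.1 (w k).1.1 := e (Sum.inl k)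
          have e2 : h.1 (w k).2.1 = h'.1 (w k).2.1 := e (Sum.inr k)
          simp [excess, errInd, e1, e2] }
  have h1 := L.measure_error_ge_le ε
  have h2 : ∀ S : Fin N → DataPoint X n, ∫ z, errInd c (erm (paddedSample c j s a S)) z ∂(dataLaw η D) =
      D.real {x | erm (paddedSample c j s a S) x ≠ c x} := fun S =>
    integral_errInd hcm (hCm _ (hE.mem _))
  simpa only [h2] using h1

end Padded

end CrowdPAC

noncomputable section

namespace CrowdPAC

/-! ## The program -/

/-- Run a program from the state `σ`. -/
def run {X : Type*} {n s : ℕ} (erm : List (X × Bool) → X → Bool) (c : X → Bool)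
    (z : Fin s → DataPoint X n) (σ : State X) (l : List (Instr s)) : State X :=
  l.foldl (step erm c z) σ

/-- The registers of tag `t`. -/
def reg (t i j : ℕ) : ℕ := Nat.pair t (Nat.pair i j)

-- Writes under different tags do not interfere. The tags are: 0 constants, 1 threshold, 2 labels of
-- ground-truth points, 3 doubled votes, 4 and 5 scratch, 6 scores, 7 the padding label, 8 the
-- chosen worker, 9 labels of the sample.
@[simp] lemma reg_inj {t i j t' i' j' : ℕ} :
    reg t i j = reg t' i' j' ↔ t = t' ∧ i = i' ∧ j = j' := by
  simp [reg, Nat.pair_eq_pair]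

/-! ### Loop rules for straight-line programs. -/

section Run

variable {X : Type*} {n s : ℕ} {erm : List (X × Bool) → X → Bool} {c : X → Bool}
  {z : Fin s → DataPoint X n} {α β : Type*}

lemma run_append (σ : State X) (l l' : List (Instr s)) :
    run erm c z σ (l ++ l') = run erm c z (run erm c z σ l) l' := List.foldl_append

/-- Loop invariants. -/
lemma run_flatMap_induction (f : α → List (Instr s)) (I : List α → State X → Prop) (l : List α)
    (hs : ∀ l' a τ, I l' τ → I (l' ++ [a]) (run erm c z τ (f a))) {σ : State X} (h0 : I [] σ) :
    I l (run erm c z σ (l.flatMap f)) := by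
  induction l using List.reverseRecOn with
  | nil => exact h0
  | append_singleton l a ih =>
    rw [List.flatMap_append, run_append, List.flatMap_singleton]
    exact hs l a _ ih

/-- A loop whose passes write distinct registers. -/
lemma run_flatMap_write {f : α → List (Instr s)} (Pre : State X → Prop) (r v : α → ℕ)
    (hs : ∀ τ, Pre τ → ∀ a, Pre (run erm c z τ (f a)) ∧ (run erm c z τ (f a)).num (r a) = v a ∧
      ∀ b, b ≠ a → (run erm c z τ (f a)).num (r b) = τ.num (r b))
    (l : List α) {σ : State X} (h0 : Pre σ) :
    Pre (run erm c z σ (l.flatMap f)) ∧ ∀ a ∈ l, (run erm c z σ (l.flatMap f)).num (r a) = v a := by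
  refine run_flatMap_induction f (fun l' τ => Pre τ ∧ ∀ a ∈ l', τ.num (r a) = v a) l ?_
    ⟨h0, by simp⟩
  rintro l' a τ ⟨hτ, hl⟩
  obtain ⟨h1, h2, h3⟩ := hs τ hτ a
  refine ⟨h1, fun b hb => ?_⟩
  by_cases e : b = a
  · rw [e, h2]
  · rw [h3 b e]
    exact hl b (by simpa [e] using hb)

/-- A loop that adds to registers. -/
lemma run_flatMap_add {f : α → List (Instr s)} (Pre : State X → Prop) (r : β → ℕ) (w : α → β → ℕ)
    (hs : ∀ τ, Pre τ → ∀ a, Pre (run erm c z τ (f a)) ∧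
      ∀ b, (run erm c z τ (f a)).num (r b) = τ.num (r b) + w a b)
    (l : List α) {σ : State X} (h0 : Pre σ) :
    Pre (run erm c z σ (l.flatMap f)) ∧
      ∀ b, (run erm c z σ (l.flatMap f)).num (r b) = σ.num (r b) + (l.map (w · b)).sum := by
  refine run_flatMap_induction f (fun l' τ => Pre τ ∧
    ∀ b, τ.num (r b) = σ.num (r b) + (l'.map (w · b)).sum) l ?_ ⟨h0, by simp⟩
  rintro l' a τ ⟨hτ, hl⟩
  obtain ⟨h1, h2⟩ := hs τ hτ a
  refine ⟨h1, fun b => ?_⟩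
  rw [h2, hl]; simp; ring

end Run

/-- The list of all elements of a finite type. -/
def all (α : Type*) [Fintype α] : List α := (Finset.univ : Finset α).toList

@[simp] lemma mem_all {α : Type*} [Fintype α] (a : α) : a ∈ all α := by simp [all]

@[simp] lemma length_all (α : Type*) [Fintype α] : (all α).length = Fintype.card α := by simp [all]

lemma sum_map_all {α : Type*} [Fintype α] {M : Type*} [AddCommMonoid M] (f : α → M) :
    ((all α).map f).sum = ∑ a, f a := by simp [all]

/-! ### The code of the learner, its number of tasks and its running time. -/

section Code

variable (n T N a θ : ℕ)

/-- Load the constants `0, …, n + 2`. -/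
def constCode (j : Fin (n + 3)) : List (Instr (T + N)) := [.const (reg 0 j 0) j]

/-- Ask a worker about a ground-truth point. -/
def askCode (p : Fin T × Fin n) : List (Instr (T + N)) :=
  [.query (reg 2 p.1 p.2) (reg 0 p.2 0) (Fin.castAdd N p.1)]

/-- Add twice the label to the votes. -/
def voteCode (p : Fin T × Fin n) : List (Instr (T + N)) :=
  [.add (reg 3 p.1 0) (reg 3 p.1 0) (reg 2 p.1 p.2), .add (reg 3 p.1 0) (reg 3 p.1 0) (reg 2 p.1 p.2)]

/-- Add the contribution of one ground-truth point to the score of a worker on the label `s`. -/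
def scoreCode (p : Fin T × Fin n × Bool) : List (Instr (T + N)) :=
  -- Tag 4 receives `2` or `0` according to whether the label equals `s`. Tag 5 keeps this value if
  -- the majority vote is `s` and receives the neutral value `1` otherwise.
  [.select (reg 4 0 0) (reg 2 p.1 p.2.1) (reg 0 0 0) (reg 0 (bif p.2.2 then 0 else 2) 0)
      (reg 0 (bif p.2.2 then 2 else 0) 0),
    .select (reg 5 0 0) (reg 0 n 0) (reg 3 p.1 0) (bif p.2.2 then reg 4 0 0 else reg 0 1 0)
      (bif p.2.2 then reg 0 1 0 else reg 4 0 0),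
    .add (reg 6 p.2.1 p.2.2.toNat) (reg 6 p.2.1 p.2.2.toNat) (reg 5 0 0)]

/-- Choose the worker and the label if their score reaches the threshold. -/
def chooseCode (p : Fin n × Bool) : List (Instr (T + N)) :=
  [.select (reg 7 0 0) (reg 1 0 0) (reg 6 p.1 p.2.toNat) (reg 0 (!p.2).toNat 0) (reg 7 0 0),
    .select (reg 8 0 0) (reg 1 0 0) (reg 6 p.1 p.2.toNat) (reg 0 p.1 0) (reg 8 0 0)]

/-- Ask the chosen worker about a point of the sample. -/
def sampleCode (k : Fin N) : List (Instr (T + N)) :=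
  [.query (reg 9 k 0) (reg 8 0 0) (Fin.natAdd T k)]

/-- Call the disagreement minimiser on the padded sample. -/
def ermCode : List (Instr (T + N)) :=
  [.erm 0 ((paddedIndex N a).map fun q =>
    (Fin.natAdd T q.1, bif q.2 then reg 9 q.1 0 else reg 7 0 0))]

/-- All `n` workers label `T` points, whose true labels are estimated by majority votes. A worker and
a label `s` of score at least `θ` are chosen, and the concept is learned from `N` further points that
this worker labels. -/
def crowdLearner : Learner where
  draws := T + N
  picks := 0
  code := (all (Fin (n + 3))).flatMap (constCode n T N) ++ ([.const (reg 1 0 0) θ] ++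
    ((all (Fin T × Fin n)).flatMap (askCode n T N) ++
    ((all (Fin T × Fin n)).flatMap (voteCode n T N) ++
    ((all (Fin T × Fin n × Bool)).flatMap (scoreCode n T N) ++
    ((all (Fin n × Bool)).flatMap (chooseCode n T N) ++
    ((all (Fin N)).flatMap (sampleCode T N) ++ ermCode T N a))))))

lemma tasks_crowdLearner : (crowdLearner n T N a θ).tasks = T * n + N := by
  simp [Learner.tasks, crowdLearner, List.countP_flatMap, constCode, askCode, voteCode, scoreCode,
    chooseCode, sampleCode, ermCode, Instr.isTask, Function.comp_def, List.countP_cons]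

lemma sum_cost_flatMap {s : ℕ} {α : Type*} [Fintype α] (f : α → List (Instr s)) :
    (((all α).flatMap f).map Instr.cost).sum = ∑ x, ((f x).map Instr.cost).sum := by
  rw [← sum_map_all]
  induction all α with
  | nil => rfl
  | cons x l ih => simp [ih]

lemma length_paddedIndex : (paddedIndex N a).length = N * (a + 1) := by
  simp [paddedIndex, List.length_flatMap]

lemma time_crowdLearner : (crowdLearner n T N a θ).time ≤
    T + N + (n + 3) * (n + 3) + (θ + 1) + 9 * (T * n) + 4 * n + N + (N * (a + 1) + 1) := by
  have h0 : ∑ x : Fin (n + 3), ((x : ℕ) + 1) ≤ (n + 3) * (n + 3) := by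
    have h : ∀ x : Fin (n + 3), (x : ℕ) + 1 ≤ n + 3 := fun x => x.2
    simpa using Finset.sum_le_card_nsmul Finset.univ _ _ fun x _ => h x
  have e : (crowdLearner n T N a θ).time = T + N + 0 + (∑ x : Fin (n + 3), ((x : ℕ) + 1) +
      ((θ + 1) + (T * n + (T * n * 2 + (T * (n * 2) * 3 + (n * 2 * 2 + (N + (N * (a + 1) + 1)))))))) := by
    simp only [Learner.time, crowdLearner, List.map_append, List.sum_append, sum_cost_flatMap]
    simp [constCode, askCode, voteCode, scoreCode, chooseCode, sampleCode, ermCode, Instr.cost,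
      length_paddedIndex]
  rw [e]
  nlinarith

end Code

/-! ### Correctness of the program. -/

section Semantics

variable {X : Type*} {n T N : ℕ} (c : X → Bool)

/-- The majority vote on a data point. -/
def majority (z : DataPoint X n) : Bool := decide (n ≤ 2 * ∑ j, (DataPoint.label c z j).toNat)

/-- The contribution of a point of presumed label `t`, labelled `l`, to the score for `s`. -/
def scoreTerm (t l s : Bool) : ℕ := if t = s then if l = s then 2 else 0 else 1

/-- The score of worker `j` on the label `s`. -/
def score (z : Fin T → DataPoint X n) (j : Fin n) (s : Bool) : ℕ :=
  ∑ e, scoreTerm (majority c (z e)) (DataPoint.label c (z e) j) s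

variable {c} {erm : List (X × Bool) → X → Bool} {a θ : ℕ}

/-- What is stored before the scores are computed. -/
structure Labelled (c : X → Bool) (z : Fin (T + N) → DataPoint X n) (θ : ℕ) (τ : State X) : Prop where
  num_const : ∀ j < n + 3, τ.num (reg 0 j 0) = j
  num_threshold : τ.num (reg 1 0 0) = θ
  num_label : ∀ e j, τ.num (reg 2 (e : Fin T) (j : Fin n)) =
    (DataPoint.label c (z (Fin.castAdd N e)) j).toNat

/-- The voting, scoring and choosing code writes only at tags above `2`, so the stored data survive
it. -/
lemma Labelled.setNum {z : Fin (T + N) → DataPoint X n} {τ : State X} (h : Labelled c z θ τ)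
    {t i j v : ℕ} (ht : 2 < t) : Labelled c z θ (τ.setNum (reg t i j) v) := by
  constructor
  · intro k hk
    have hne : reg 0 k 0 ≠ reg t i j := fun e => by have := (reg_inj.1 e).1; omega
    exact (Function.update_of_ne hne _ _).trans (h.num_const k hk)
  · rw [← h.num_threshold]
    exact Function.update_of_ne (by simp; omega) _ _
  · intro e k
    rw [← h.num_label]
    exact Function.update_of_ne (by simp; omega) _ _

lemma num_setNum (τ : State X) (r v r' : ℕ) :
    (τ.setNum r v).num r' = if r' = r then v else τ.num r' := by
  simp [State.setNum, Function.update_apply]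

/-- The state after the labelling of the ground-truth points. -/
lemma run_labelled (z : Fin (T + N) → DataPoint X n) {σ : State X} (hσ : ∀ r, σ.num r = 0) :
    ∃ τ, run erm c z σ ((all (Fin (n + 3))).flatMap (constCode n T N) ++ ([.const (reg 1 0 0) θ] ++
      (all (Fin T × Fin n)).flatMap (askCode n T N))) = τ ∧ Labelled c z θ τ ∧
      ∀ t i j, 2 < t → τ.num (reg t i j) = 0 := by
  refine ⟨_, rfl, ?_⟩
  rw [run_append, run_append]
  obtain ⟨h1, h2⟩ := run_flatMap_write (erm := erm) (c := c) (z := z) (f := constCode n T N)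
    (fun τ => ∀ t i j, 2 < t → τ.num (reg t i j) = 0) (fun j => reg 0 j 0) (fun j => j)
    (fun τ hτ a => by
      refine ⟨fun t i j ht => ?_, ?_, fun b hb => ?_⟩
      · have : t ≠ 0 := by omega
        simp [run, constCode, step, num_setNum, hτ t i j ht, this]
      · simp [run, constCode, step, num_setNum]
      · have : (b : ℕ) ≠ a := fun h => hb (Fin.ext h)
        simp [run, constCode, step, num_setNum, this])
    (all (Fin (n + 3))) (σ := σ) (fun t i j _ => hσ _)
  set τ₁ := run erm c z σ ((all (Fin (n + 3))).flatMap (constCode n T N))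
  obtain ⟨⟨h3, h4, h5⟩, h6⟩ := run_flatMap_write (erm := erm) (c := c) (z := z) (f := askCode n T N)
    (fun τ => (∀ t i j, 2 < t → τ.num (reg t i j) = 0) ∧ (∀ j < n + 3, τ.num (reg 0 j 0) = j) ∧
      τ.num (reg 1 0 0) = θ) (fun p => reg 2 p.1 p.2)
    (fun p => (DataPoint.label c (z (Fin.castAdd N p.1)) p.2).toNat)
    (fun τ ⟨hτ, hc, hθ⟩ p => by
      refine ⟨⟨fun t i j ht => ?_, fun j hj => ?_, ?_⟩, ?_, fun b hb => ?_⟩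
      · have : t ≠ 2 := by omega
        simp [run, askCode, step, num_setNum, hτ t i j ht, this]
      · simp [run, askCode, step, num_setNum, hc j hj]
      · simp [run, askCode, step, num_setNum, hθ]
      · have := hc p.2 (by omega)
        simp [run, askCode, step, num_setNum, this]
      · have : ¬ ((b.1 : ℕ) = p.1 ∧ (b.2 : ℕ) = p.2) := fun h =>
          hb (Prod.ext (Fin.ext h.1) (Fin.ext h.2))
        simp [run, askCode, step, num_setNum, this])
    (all (Fin T × Fin n)) (σ := run erm c z τ₁ [.const (reg 1 0 0) θ])
    ⟨fun t i j ht => by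
        have : t ≠ 1 := by omega
        simp [run, step, num_setNum, h1 t i j ht, this],
      fun j hj => by simpa [run, step, num_setNum] using h2 ⟨j, hj⟩ (mem_all _),
      by simp [run, step, num_setNum]⟩
  exact ⟨⟨h4, h5, fun e j => h6 (e, j) (mem_all _)⟩, h3⟩

/-- The state after the votes and the scores have been computed. -/
lemma run_scores (z : Fin (T + N) → DataPoint X n) {σ : State X} (hL : Labelled c z θ σ)
    (h0 : ∀ t i j, 2 < t → σ.num (reg t i j) = 0) :
    ∃ τ, run erm c z σ ((all (Fin T × Fin n)).flatMap (voteCode n T N) ++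
      (all (Fin T × Fin n × Bool)).flatMap (scoreCode n T N)) = τ ∧ Labelled c z θ τ ∧
      ∀ (j : Fin n) (s : Bool), τ.num (reg 6 j s.toNat) =
        score c (fun e => z (Fin.castAdd N e)) j s := by
  refine ⟨_, rfl, ?_⟩
  rw [run_append]
  obtain ⟨⟨h1, h2⟩, h3⟩ := run_flatMap_add (erm := erm) (c := c) (z := z) (f := voteCode n T N)
    -- The invariant also records that the score registers stay zero, as the next loop accumulates
    -- into them.
    (fun τ => Labelled c z θ τ ∧ ∀ i j, τ.num (reg 6 i j) = 0) (fun e : Fin T => reg 3 e 0)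
    (fun p e => if p.1 = e then 2 * (DataPoint.label c (z (Fin.castAdd N p.1)) p.2).toNat else 0)
    (fun τ ⟨hτ, h6⟩ p => by
      refine ⟨⟨(hτ.setNum (by norm_num)).setNum (by norm_num), fun i j => ?_⟩, fun e => ?_⟩
      · simp [run, voteCode, step, num_setNum, h6]
      · have := hτ.num_label p.1 p.2
        by_cases e1 : p.1 = e
        · subst e1
          simp [run, voteCode, step, num_setNum, this]; ring
        · have e2 : (e : ℕ) ≠ p.1 := fun h => e1 (Fin.ext h.symm)
          simp [run, voteCode, step, num_setNum, e1, e2])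
    (all (Fin T × Fin n)) (σ := σ) ⟨hL, fun i j => h0 6 i j (by norm_num)⟩
  set τ₁ := run erm c z σ ((all (Fin T × Fin n)).flatMap (voteCode n T N))
  have hV : ∀ e : Fin T, τ₁.num (reg 3 e 0) =
      2 * ∑ j, (DataPoint.label c (z (Fin.castAdd N e)) j).toNat := fun e => by
    rw [h3, h0 3 _ _ (by norm_num), sum_map_all, Fintype.sum_prod_type, zero_add,
      Finset.sum_eq_single e, Finset.mul_sum]
    · simp
    · intro b _ hb; simp [hb]
    · simp
  obtain ⟨⟨h4, -⟩, h5⟩ := run_flatMap_add (erm := erm) (c := c) (z := z) (f := scoreCode n T N)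
    (fun τ => Labelled c z θ τ ∧ ∀ e : Fin T, τ.num (reg 3 e 0) =
      2 * ∑ j, (DataPoint.label c (z (Fin.castAdd N e)) j).toNat)
    (fun q : Fin n × Bool => reg 6 q.1 q.2.toNat)
    (fun p q => if p.2 = q then scoreTerm (majority c (z (Fin.castAdd N p.1)))
      (DataPoint.label c (z (Fin.castAdd N p.1)) p.2.1) p.2.2 else 0)
    (fun τ ⟨hτ, hv⟩ ⟨e, j, s⟩ => by
      refine ⟨⟨((hτ.setNum (by norm_num)).setNum (by norm_num)).setNum (by norm_num),
        fun i => ?_⟩, fun ⟨j', s'⟩ => ?_⟩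
      · simp [run, scoreCode, step, num_setNum, hv]
      · have hl := hτ.num_label e j
        have k0 := hτ.num_const 0 (by omega)
        have k1 := hτ.num_const 1 (by omega)
        have k2 := hτ.num_const 2 (by omega)
        have kn := hτ.num_const n (by omega)
        by_cases e1 : j = j' ∧ s = s'
        · obtain ⟨rfl, rfl⟩ := e1
          cases s <;> cases hlab : DataPoint.label c (z (Fin.castAdd N e)) j <;>
            by_cases hm : n ≤ 2 * ∑ j, (DataPoint.label c (z (Fin.castAdd N e)) j).toNat <;>
            simp [run, scoreCode, step, num_setNum, hl, hv, k0, k1, k2, kn, hlab, hm, majority,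
              scoreTerm]
        · have e2 : ¬ ((j' : ℕ) = j ∧ s'.toNat = s.toNat) := fun h =>
            e1 ⟨Fin.ext h.1.symm, by have := h.2; cases s <;> cases s' <;> simp_all⟩
          have e3 : ¬ ((j, s) = (j', s')) := fun h => e1 (by simpa using h)
          simp only [e3, if_false, add_zero]
          simp [run, scoreCode, step, num_setNum, e2])
    (all (Fin T × Fin n × Bool)) (σ := τ₁) ⟨h1, hV⟩
  refine ⟨h4, fun j s => ?_⟩
  rw [h5 (j, s), h2, zero_add, sum_map_all, Fintype.sum_prod_type, score]
  refine Finset.sum_congr rfl fun e _ => ?_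
  simp

/-- The state after a worker and a label have been chosen. -/
lemma run_choose (z : Fin (T + N) → DataPoint X n) {σ : State X} (hL : Labelled c z θ σ)
    (hS : ∀ (j : Fin n) (s : Bool), σ.num (reg 6 j s.toNat) =
        score c (fun e => z (Fin.castAdd N e)) j s)
    (hθ : ∃ j s, θ ≤ score c (fun e => z (Fin.castAdd N e)) j s) :
    ∃ τ, run erm c z σ ((all (Fin n × Bool)).flatMap (chooseCode n T N)) = τ ∧
      ∃ j s, θ ≤ score c (fun e => z (Fin.castAdd N e)) j s ∧ τ.num (reg 7 0 0) = (!s).toNat ∧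
        τ.num (reg 8 0 0) = j := by
  refine ⟨_, rfl, ?_⟩
  -- Each passing pair overwrites the previous choice. Once a pair has passed, the stored worker and
  -- label always come from a passing pair; before that nothing is claimed.
  have h := run_flatMap_induction (erm := erm) (c := c) (z := z) (chooseCode n T N) (fun l τ =>
    (Labelled c z θ τ ∧ ∀ (j : Fin n) (s : Bool), τ.num (reg 6 j s.toNat) =
        score c (fun e => z (Fin.castAdd N e)) j s) ∧
    ((∃ p ∈ l, θ ≤ score c (fun e => z (Fin.castAdd N e)) p.1 p.2) →
      ∃ j s, θ ≤ score c (fun e => z (Fin.castAdd N e)) j s ∧ τ.num (reg 7 0 0) = (!s).toNat ∧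
        τ.num (reg 8 0 0) = j)) (all (Fin n × Bool)) ?_ (σ := σ) ⟨⟨hL, hS⟩, by simp⟩
  · obtain ⟨j, s, hjs⟩ := hθ
    exact h.2 ⟨(j, s), mem_all _, hjs⟩
  · rintro l ⟨j, s⟩ τ ⟨⟨hτ, h6⟩, hl⟩
    have kθ := hτ.num_threshold
    have kj := hτ.num_const j (by omega)
    have ks := hτ.num_const (!s).toNat (by have := Bool.toNat_le (!s); omega)
    refine ⟨⟨(hτ.setNum (by norm_num)).setNum (by norm_num), fun i s' => ?_⟩, ?_⟩
    · simp [run, chooseCode, step, num_setNum, h6]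
    · rintro ⟨p, hp, hpθ⟩
      by_cases hjs : θ ≤ score c (fun e => z (Fin.castAdd N e)) j s
      · refine ⟨j, s, hjs, ?_, ?_⟩
        · simp [run, chooseCode, step, num_setNum, kθ, h6, hjs, ks]
        · simp [run, chooseCode, step, num_setNum, kθ, h6, hjs, kj]
      · have hpl : p ∈ l := by
          rcases List.mem_append.1 hp with h | h
          · exact h
          · rw [List.mem_singleton.1 h] at hpθ
            exact absurd hpθ hjs
        obtain ⟨j', s', h1, h2, h3⟩ := hl ⟨p, hpl, hpθ⟩
        refine ⟨j', s', h1, ?_, ?_⟩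
        · simp [run, chooseCode, step, num_setNum, kθ, h6, hjs, h2]
        · simp [run, chooseCode, step, num_setNum, kθ, h6, hjs, h3]

/-- The state after the sample has been labelled by the chosen worker. -/
lemma run_sample (z : Fin (T + N) → DataPoint X n) {σ : State X} {j : Fin n} {v : ℕ}
    (h7 : σ.num (reg 7 0 0) = v) (h8 : σ.num (reg 8 0 0) = j) :
    ∃ τ, run erm c z σ ((all (Fin N)).flatMap (sampleCode T N)) = τ ∧ τ.num (reg 7 0 0) = v ∧
      ∀ k : Fin N, τ.num (reg 9 k 0) = (DataPoint.label c (z (Fin.natAdd T k)) j).toNat := by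
  refine ⟨_, rfl, ?_⟩
  obtain ⟨⟨h1, -⟩, h2⟩ := run_flatMap_write (erm := erm) (c := c) (z := z) (f := sampleCode T N)
    (fun τ => τ.num (reg 7 0 0) = v ∧ τ.num (reg 8 0 0) = j) (fun k => reg 9 k 0)
    (fun k => (DataPoint.label c (z (Fin.natAdd T k)) j).toNat)
    (fun τ ⟨ha, hb⟩ k => by
      refine ⟨⟨?_, ?_⟩, ?_, fun k' hk => ?_⟩
      · simp [run, sampleCode, step, num_setNum, ha]
      · simp [run, sampleCode, step, num_setNum, hb]
      · simp [run, sampleCode, step, num_setNum, hb]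
      · have : (k' : ℕ) ≠ k := fun h => hk (Fin.ext h)
        simp [run, sampleCode, step, num_setNum, this])
    (all (Fin N)) (σ := σ) ⟨h7, h8⟩
  exact ⟨h1, fun k => h2 k (mem_all _)⟩

lemma hyp_run_ermCode (z : Fin (T + N) → DataPoint X n) (σ : State X) :
    (run erm c z σ (ermCode T N a)).hyp 0 = erm ((paddedIndex N a).map fun q =>
      ((z (Fin.natAdd T q.1)).1, decide (σ.num (bif q.2 then reg 9 q.1 0 else reg 7 0 0) ≠ 0))) := by
  simp [run, ermCode, step, State.setHyp, Function.comp_def]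

theorem output_crowdLearner_mem {C : Set (X → Bool)} (hE : ∀ S, erm S ∈ C)
    (ω : (crowdLearner n T N a θ).Input X n) : (crowdLearner n T N a θ).output erm c ω ∈ C := by
  change (run erm c ω.1 _ (crowdLearner n T N a θ).code).hyp 0 ∈ C
  simp only [crowdLearner, run_append]
  rw [hyp_run_ermCode]
  exact hE _

/-- If some score reaches the threshold, then the learner returns the concept of a padded sample
of a worker and a label of such a score. -/
theorem output_crowdLearner (ω : (crowdLearner n T N a θ).Input X n)
    (hθ : ∃ j s, θ ≤ score c (fun e => ω.1 (Fin.castAdd N e)) j s) :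
    ∃ j s, θ ≤ score c (fun e => ω.1 (Fin.castAdd N e)) j s ∧
      (crowdLearner n T N a θ).output erm c ω =
        erm (paddedSample c j s a fun k => ω.1 (Fin.natAdd T k)) := by
  obtain ⟨z, pk⟩ := ω
  change Fin (T + N) → DataPoint X n at z
  set σ : State X := { num := fun j => if hj : j < (crowdLearner n T N a θ).picks then
    (pk ⟨j, hj⟩ : ℕ) else 0, hyp := fun _ => erm [] } with hσ
  -- No random workers are drawn, so all number registers start at the default `0`.
  have h0 : ∀ r, σ.num r = 0 := fun r => by simp [hσ, crowdLearner]
  obtain ⟨τ₁, e1, hL1, hz1⟩ := run_labelled (erm := erm) (c := c) (θ := θ) z h0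
  obtain ⟨τ₂, e2, hL2, hS2⟩ := run_scores (erm := erm) z hL1 hz1
  obtain ⟨τ₃, e3, j, s, hjs, h7, h8⟩ := run_choose (erm := erm) z hL2 hS2 hθ
  obtain ⟨τ₄, e4, h7', h9⟩ := run_sample (erm := erm) (c := c) z h7 h8
  refine ⟨j, s, hjs, ?_⟩
  change (run erm c z σ (crowdLearner n T N a θ).code).hyp 0 = _
  have e : run erm c z σ (crowdLearner n T N a θ).code = run erm c z τ₄ (ermCode T N a) := by
    rw [← e4, ← e3, ← e2, ← e1]
    simp only [crowdLearner, run_append]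
  rw [e, hyp_run_ermCode]
  congr 1
  refine List.map_congr_left fun q _ => ?_
  rcases q with ⟨k, _ | _⟩
  · cases s <;> simp [paddedEntry, h7']
  · cases hlab : DataPoint.label c (z (Fin.natAdd T k)) j <;> simp [paddedEntry, h9, hlab]

end Semantics

end CrowdPAC

end

noncomputable section

namespace CrowdPAC

/-! ## Concentration -/

/-- Hoeffding's inequality on a product space. -/
lemma measure_pi_sum_ge_le {ι : Type*} [Fintype ι] {Ω : ι → Type*} [∀ i, MeasurableSpace (Ω i)]
    (μ : ∀ i, Measure (Ω i)) [∀ i, IsProbabilityMeasure (μ i)] {f : ∀ i, Ω i → ℝ}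
    (hf : ∀ i, Measurable (f i)) {u v : ℝ} (hb : ∀ i ω, f i ω ∈ Set.Icc u v) {t : ℝ} (ht : 0 ≤ t) :
    (Measure.pi μ).real {ω | ∑ i, ∫ x, f i x ∂(μ i) + t ≤ ∑ i, f i (ω i)} ≤
      Real.exp (-(2 * t ^ 2 / (Fintype.card ι * (v - u) ^ 2))) := by
  have hX : ∀ i, Measurable fun x => f i x - ∫ x, f i x ∂(μ i) := fun i => (hf i).sub_const _
  have hind := iIndepFun_pi (μ := μ) (X := fun i x => f i x - ∫ x, f i x ∂(μ i))
    fun i => (hX i).aemeasurable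
  have hsub : ∀ i ∈ Finset.univ, HasSubgaussianMGF (fun ω : ∀ i, Ω i => f i (ω i) - ∫ x, f i x ∂(μ i))
      ((‖v - u‖₊ / 2) ^ 2) (Measure.pi μ) := fun i _ => by
    have h := hasSubgaussianMGF_of_mem_Icc (μ := Measure.pi μ) (X := fun ω : ∀ i, Ω i => f i (ω i))
      (a := u) (b := v) ((hf i).comp (measurable_pi_apply i)).aemeasurable
      (ae_of_all _ fun ω => hb i (ω i))
    rwa [integral_comp_eval (μ := μ) (hf i).aestronglyMeasurable] at h
  have h := HasSubgaussianMGF.measure_sum_ge_le_of_iIndepFun hind hsub ht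
  refine le_trans (measureReal_mono fun ω hω => ?_) (h.trans (le_of_eq ?_))
  · simp only [Set.mem_ofPred_eq, Finset.sum_sub_distrib] at hω ⊢
    linarith
  · congr 1
    rw [Finset.sum_const, Finset.card_univ, nsmul_eq_mul]
    push_cast
    rw [Real.norm_eq_abs, div_pow, sq_abs, neg_div, neg_inj]
    -- With no coordinates or with `u = v` both quotients are divisions by zero, hence equal to `0`.
    by_cases h0 : (Fintype.card ι : ℝ) * (v - u) ^ 2 = 0
    · rw [h0, show (2 : ℝ) * (Fintype.card ι * ((v - u) ^ 2 / 2 ^ 2)) =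
        Fintype.card ι * (v - u) ^ 2 / 2 by ring, h0]; simp
    · have h1 := left_ne_zero_of_mul h0
      have h2 := right_ne_zero_of_mul h0
      field_simp

/-- Valid for arbitrary sets `s`, so the failure events need not be shown to be measurable. -/
lemma measureReal_preimage_le {Ω Ω' : Type*} [MeasurableSpace Ω] [MeasurableSpace Ω'] {μ : Measure Ω}
    {ν : Measure Ω'} [IsFiniteMeasure ν] {f : Ω → Ω'} (hf : MeasurePreserving f μ ν) (s : Set Ω') :
    μ.real (f ⁻¹' s) ≤ ν.real s := by
  refine ENNReal.toReal_mono (measure_ne_top _ _) ?_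
  rw [← hf.map_eq]
  exact Measure.le_map_apply hf.measurable.aemeasurable s

/-- This isolates the ground-truth points and the sample points within the one family of draws. -/
lemma measurePreserving_precomp {ι κ Ω : Type*} [Fintype ι] [Fintype κ] [MeasurableSpace Ω]
    (μ : Measure Ω) [IsProbabilityMeasure μ] {f : κ → ι} (hf : f.Injective) :
    MeasurePreserving (fun (z : ι → Ω) k => z (f k)) (Measure.pi fun _ => μ)
      (Measure.pi fun _ => μ) := by
  refine ⟨by fun_prop, ?_⟩
  have h1 : iIndepFun (fun (i : ι) (z : ι → Ω) => z i) (Measure.pi fun _ => μ) :=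
    iIndepFun_pi (μ := fun _ : ι => μ) (X := fun _ x => x) fun _ => aemeasurable_id'
  have h2 := (h1.precomp hf).map_fun_eq_pi_map fun k => (measurable_pi_apply (f k)).aemeasurable
  simpa [Function.comp_def, (measurePreserving_eval (fun _ : ι => μ) _).map_eq] using h2

/-! ### Majority votes, scores and the failure probability. -/

section Crowd

variable {X : Type*} {n : ℕ} {c : X → Bool}

/-- At least half of the workers err, in case that the true label is `l`. -/
def NoisyMajority (l : Bool) (u : Fin n → Bool → Bool) : Prop := n ≤ 2 * ∑ j, (u j l).toNat

/-- A wrong vote needs at least half of the workers to err, ties included. The resulting event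
concerns the noise alone, at the cost of allowing either true label. -/
lemma exists_noisyMajority {z : DataPoint X n} (h : majority c z ≠ c z.1) :
    ∃ l, NoisyMajority l z.2 := by
  refine ⟨c z.1, ?_⟩
  unfold majority at h
  unfold NoisyMajority
  cases hc : c z.1
  · simpa [hc, DataPoint.label] using h
  · have h1 : 2 * ∑ j, (!(z.2 j true)).toNat < n := by
      simpa [hc, DataPoint.label] using h
    have h2 : ∑ j, ((z.2 j true).toNat + (!(z.2 j true)).toNat) = n := by
      have : ∀ j, (z.2 j true).toNat + (!(z.2 j true)).toNat = 1 := fun j => by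
        cases z.2 j true <;> rfl
      simp [this]
    rw [Finset.sum_add_distrib] at h2
    omega

/-- The signed agreement of worker `j` with the target, on the examples of label `s`. -/
def agree (c : X → Bool) (j : Fin n) (s : Bool) (z : DataPoint X n) : ℝ :=
  if c z.1 = s then if z.2 j s then -1 else 1 else 0

lemma agree_mem_Icc (j : Fin n) (s : Bool) (z : DataPoint X n) : agree c j s z ∈ Set.Icc (-1 : ℝ) 1 := by
  unfold agree; split_ifs <;> simp

/-- Each score term is one plus a signed agreement; the shift by `T` keeps scores natural numbers.
-/
lemma score_eq {T : ℕ} {z : Fin T → DataPoint X n} (hz : ∀ e, majority c (z e) = c (z e).1) (j : Fin n)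
    (s : Bool) : (score c z j s : ℝ) = T + ∑ e, agree c j s (z e) := by
  have h : ∀ e, (scoreTerm (majority c (z e)) (DataPoint.label c (z e) j) s : ℝ) =
      1 + agree c j s (z e) := fun e => by
    rw [hz e]
    unfold scoreTerm agree DataPoint.label
    cases hc : c (z e).1 <;> cases s <;> simp <;> cases (z e).2 j _ <;> simp <;> norm_num
  rw [score, Nat.cast_sum, Finset.sum_congr rfl fun e _ => h e, Finset.sum_add_distrib]
  simp

variable [MeasurableSpace X] {η : Fin n → Bool → unitInterval} {D : Measure X}

lemma inputLaw_prod_univ [Nonempty (Fin n)] (P : Learner) (B : Set (Fin P.draws → DataPoint X n)) :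
    (P.inputLaw η D).real (B ×ˢ Set.univ) = (Measure.pi fun _ : Fin P.draws => dataLaw η D).real B := by
  unfold Learner.inputLaw
  rw [measureReal_prod_prod, probReal_univ, mul_one]

variable [IsProbabilityMeasure D]

instance [Nonempty (Fin n)] (P : Learner) : IsProbabilityMeasure (P.inputLaw η D) := by
  unfold Learner.inputLaw; infer_instance

/-- Hoeffding over the workers: the expected number of errors is at most `n * M`, so a noisy
majority is a deviation by at least `n * (1 / 2 - M)`. -/
lemma measure_noisyMajority_le (hn : 0 < n) {M : ℝ} (hM : M < 1 / 2) {l : Bool}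
    (hη : avgError η l ≤ M) :
    (Measure.pi fun i => Measure.pi fun b => bernoulliMeasure true false (η i b)).real
      {u | NoisyMajority l u} ≤ Real.exp (-(n * (1 - 2 * M) ^ 2 / 2)) := by
  have hn' : (0 : ℝ) < n := by exact_mod_cast hn
  have hm : Measurable fun v : Bool → Bool => ((v l).toNat : ℝ) := measurable_of_countable _
  have h := measure_pi_sum_ge_le
    (fun i : Fin n => Measure.pi fun b => bernoulliMeasure true false (η i b))
    (f := fun _ v => ((v l).toNat : ℝ)) (fun _ => hm) (u := 0) (v := 1)
    (fun i v => by cases v l <;> simp) (t := n * (1 / 2 - M)) (mul_nonneg hn'.le (by linarith))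
  have hint : ∀ i : Fin n, ∫ v, ((v l).toNat : ℝ)
      ∂(Measure.pi fun b => bernoulliMeasure true false (η i b)) = η i l := fun i => by
    rw [integral_comp_eval (μ := fun b => bernoulliMeasure true false (η i b)) (i := l)
      (f := fun b : Bool => (b.toNat : ℝ)) (measurable_of_countable _).aestronglyMeasurable,
      integral_bernoulliMeasure]
    simp
  simp_rw [hint] at h
  have hs : ∑ i, (η i l : ℝ) ≤ n * M := by
    rw [avgError, div_le_iff₀ hn'] at hη
    linarith
  refine le_trans (measureReal_mono fun u hu => ?_) (h.trans (le_of_eq ?_))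
  · have h1 : (n : ℝ) ≤ 2 * ∑ j, ((u j l).toNat : ℝ) := by
      have : n ≤ 2 * ∑ j, (u j l).toNat := hu
      exact_mod_cast this
    simp only [Set.mem_ofPred_eq]
    linarith
  · congr 1
    rw [Fintype.card_fin]
    field_simp
    ring

lemma measure_majority_ne_le (hn : 0 < n) {M : ℝ} (hM : M < 1 / 2) (hη : ∀ l, avgError η l ≤ M) :
    (dataLaw η D).real {z | majority c z ≠ c z.1} ≤ 2 * Real.exp (-(n * (1 - 2 * M) ^ 2 / 2)) := by
  have hsub : {z : DataPoint X n | majority c z ≠ c z.1} ⊆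
      ⋃ l, Prod.snd ⁻¹' {u | NoisyMajority l u} := fun z hz =>
    Set.mem_iUnion.2 (exists_noisyMajority hz)
  refine (measureReal_mono hsub).trans ((measureReal_iUnion_fintype_le _).trans ?_)
  have h1 : ∀ l, (dataLaw η D).real (Prod.snd ⁻¹' {u | NoisyMajority l u}) ≤
      Real.exp (-(n * (1 - 2 * M) ^ 2 / 2)) := fun l =>
    (measureReal_preimage_le measurePreserving_snd _).trans (measure_noisyMajority_le hn hM (hη l))
  refine (Finset.sum_le_sum fun l _ => h1 l).trans ?_
  simp

lemma measurable_agree (hc : Measurable c) (j : Fin n) (s : Bool) : Measurable (agree c j s) :=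
  (measurable_of_countable fun q : Bool × Bool => if q.1 = s then if q.2 then (-1 : ℝ) else 1 else 0).comp
    (f := fun z : DataPoint X n => (c z.1, z.2 j s)) ((hc.comp measurable_fst).prodMk (by fun_prop))

lemma integral_agree (hc : Measurable c) (j : Fin n) (s : Bool) :
    ∫ z, agree c j s z ∂(dataLaw η D) = D.real {x | c x = s} * (1 - 2 * η j s) := by
  have e : ∀ z : DataPoint X n, agree c j s z =
      {x | c x = s}.indicator (1 : X → ℝ) z.1 * (fun b : Bool => if b then (-1 : ℝ) else 1) (z.2 j s) :=
    fun z => by by_cases h : c z.1 = s <;> simp [agree, h]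
  rw [integral_congr_ae (ae_of_all _ e), integral_dataLaw_mul η D ({x | c x = s}.indicator 1) j s
    fun b => if b then (-1 : ℝ) else 1, integral_indicator_one (measurableSet_eq_fun hc measurable_const)]
  simp only [if_true, Bool.false_eq_true, if_false]
  ring

/-- The empirical agreement deviates from its mean by `t` or more. -/
def Deviates (η : Fin n → Bool → unitInterval) (D : Measure X) (c : X → Bool) (t : ℝ) (p : Fin n × Bool)
    {T : ℕ} (z : Fin T → DataPoint X n) : Prop :=
  T * t ≤ |∑ e, agree c p.1 p.2 (z e) - T * (D.real {x | c x = p.2} * (1 - 2 * η p.1 p.2))|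

lemma measure_deviates_le (hc : Measurable c) {t : ℝ} (ht : 0 ≤ t) (p : Fin n × Bool) {T : ℕ}
    (hT : 0 < T) :
    (Measure.pi fun _ : Fin T => dataLaw η D).real {z | Deviates η D c t p z} ≤
      2 * Real.exp (-(T * t ^ 2 / 2)) := by
  have hT' : (0 : ℝ) < T := by exact_mod_cast hT
  set m := D.real {x | c x = p.2} * (1 - 2 * (η p.1 p.2 : ℝ)) with hm
  have h1 := measure_pi_sum_ge_le (fun _ : Fin T => dataLaw η D) (f := fun _ => agree c p.1 p.2)
    (fun _ => measurable_agree hc p.1 p.2) (fun _ => agree_mem_Icc p.1 p.2) (t := T * t) (by positivity)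
  have h2 := measure_pi_sum_ge_le (fun _ : Fin T => dataLaw η D) (f := fun _ z => -agree c p.1 p.2 z)
    (fun _ => (measurable_agree hc p.1 p.2).neg) (u := -1) (v := 1)
    (fun _ z => by have := agree_mem_Icc (c := c) p.1 p.2 z; rw [Set.mem_Icc] at *; constructor <;> linarith)
    (t := T * t) (by positivity)
  have e : -(2 * (T * t) ^ 2 / ((Fintype.card (Fin T) : ℕ) * ((1 : ℝ) - -1) ^ 2)) = -(T * t ^ 2 / 2) := by
    rw [Fintype.card_fin]; field_simp; ring
  rw [e] at h1 h2
  simp only [integral_neg, integral_agree hc, Finset.sum_const, Finset.card_univ, Fintype.card_fin,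
    nsmul_eq_mul, ← hm, Finset.sum_neg_distrib] at h1 h2
  refine (measureReal_mono (s₂ := {z | T * m + T * t ≤ ∑ e, agree c p.1 p.2 (z e)} ∪
    {z | T * -m + T * t ≤ -∑ e, agree c p.1 p.2 (z e)}) fun z hz => ?_).trans
    ((measureReal_union_le _ _).trans (by linarith))
  rcases le_abs.1 (show T * t ≤ |_| from hz) with h | h
  · left; simp only [Set.mem_ofPred_eq]; linarith
  · right; simp only [Set.mem_ofPred_eq]; linarith

lemma measure_true_add_measure_false (hc : Measurable c) :
    D.real {x | c x = true} + D.real {x | c x = false} = 1 := by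
  have := probReal_add_probReal_compl (μ := D)
    (measurableSet_eq_fun hc measurable_const : MeasurableSet {x | c x = true})
  rw [← this]; congr 2; ext x; simp

/-- A worker and a label of sufficient empirical agreement exist. -/
lemma exists_threshold_le_score (hc : Measurable c) {T : ℕ} {z : Fin T → DataPoint X n} {g : ℝ} {i : Fin n}
    (hi : 2 * weightedError η D c i ≤ 1 - g) (hz : ∀ e, majority c (z e) = c (z e).1)
    (hd : ∀ p, ¬ Deviates η D c (g / 8) p z) :
    ∃ j s, (T : ℝ) * (1 + 3 * g / 8) ≤ score c z j s := by
  have hu : g ≤ D.real {x | c x = true} * (1 - 2 * η i true) +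
      D.real {x | c x = false} * (1 - 2 * η i false) := by
    have h1 := measure_true_add_measure_false (D := D) hc
    unfold weightedError at hi
    linarith
  -- Two terms with sum at least `g`: one is at least `g / 2`. A deviation below `g / 8` leaves more
  -- than `3 * g / 8`.
  obtain ⟨s, hs⟩ : ∃ s, g / 2 ≤ D.real {x | c x = s} * (1 - 2 * η i s) := by
    by_contra! h
    linarith [h true, h false]
  refine ⟨i, s, ?_⟩
  rw [score_eq hz]
  have h1 := (abs_lt.1 (not_le.1 (hd (i, s)))).1
  have hT : (0 : ℝ) ≤ T := by positivity
  have := mul_le_mul_of_nonneg_left hs hT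
  simp only at h1
  linarith

/-- A worker and a label of sufficient empirical agreement are informative. -/
lemma informative_of_threshold_le_score {T : ℕ} {z : Fin T → DataPoint X n} (hT : 0 < T) {g : ℝ}
    (hz : ∀ e, majority c (z e) = c (z e).1) (hd : ∀ p, ¬ Deviates η D c (g / 8) p z)
    {j : Fin n} {s : Bool} (hη : (η j s : ℝ) ≤ 1 / 2) (h : (T : ℝ) * (1 + 3 * g / 8) ≤ score c z j s) :
    g / 4 ≤ 1 - 2 * η j s := by
  have hT' : (0 : ℝ) < T := by exact_mod_cast hT
  rw [score_eq hz] at h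
  have h1 := (abs_lt.1 (not_le.1 (hd (j, s)))).2
  simp only at h1
  have h2 : (T : ℝ) * (g / 4) ≤ T * (D.real {x | c x = s} * (1 - 2 * η j s)) := by linarith
  refine (le_of_mul_le_mul_left h2 hT').trans ?_
  exact mul_le_of_le_one_left (by linarith) measureReal_le_one

/-- The failure probability of the learner. -/
theorem measure_crowdLearner_error_le (hn : 0 < n) {C : Set (X → Bool)} {d : ℕ}
    (hCm : ∀ h ∈ C, Measurable h) (hC : vcDim C ≤ d) {erm : List (X × Bool) → X → Bool}
    (hE : IsMinimizer C erm) (hc : c ∈ C) (hη : ∀ j l, (η j l : ℝ) ≤ 1 / 2) {M : ℝ} (hM : M < 1 / 2)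
    (hav : ∀ l, avgError η l ≤ M) {g : ℝ} (hg : 0 ≤ g) {i : Fin n}
    (hi : 2 * weightedError η D c i ≤ 1 - g) {T N a θ : ℕ} (hT : 0 < T) (ha : 8 ≤ a * g)
    (hθ : ∀ v : ℕ, θ ≤ v ↔ (T : ℝ) * (1 + 3 * g / 8) ≤ v) (ε : ℝ) :
    ((crowdLearner n T N a θ).inputLaw η D).real
      {ω | ε ≤ D.real {x | (crowdLearner n T N a θ).output erm c ω x ≠ c x}} ≤
      T * (2 * Real.exp (-(n * (1 - 2 * M) ^ 2 / 2))) +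
      (n * 2 : ℕ) * (2 * Real.exp (-(T * (g / 8) ^ 2 / 2))) +
      (n * 2 : ℕ) * ((2 * N + 1) ^ d * Real.exp (-(N * ((1 / ((a : ℝ) + 1)) ^ 2 / 16) * ε))) := by
  have hcm := hCm c hc
  have : Nonempty (Fin n) := ⟨⟨0, hn⟩⟩
  set P := crowdLearner n T N a θ
  set ν := Measure.pi fun _ : Fin (T + N) => dataLaw η D
  let bad₁ : Set (Fin (T + N) → DataPoint X n) :=
    ⋃ e : Fin T, (fun z => z (Fin.castAdd N e)) ⁻¹' {z | majority c z ≠ c z.1}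
  let bad₂ : Set (Fin (T + N) → DataPoint X n) :=
    ⋃ p : Fin n × Bool, (fun z e => z (Fin.castAdd N e)) ⁻¹' {z | Deviates η D c (g / 8) p z}
  -- The chosen pair depends on the ground-truth points. A union over all informative pairs avoids
  -- conditioning on the choice and costs only a factor `2 * n`.
  let bad₃ : Set (Fin (T + N) → DataPoint X n) :=
    ⋃ p : Fin n × Bool, (fun z k => z (Fin.natAdd T k)) ⁻¹'
      {S | g / 4 ≤ 1 - 2 * η p.1 p.2 ∧ ε ≤ D.real {x | erm (paddedSample c p.1 p.2 a S) x ≠ c x}}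
  have hsub : {ω | ε ≤ D.real {x | P.output erm c ω x ≠ c x}} ⊆ (bad₁ ∪ bad₂ ∪ bad₃) ×ˢ Set.univ := by
    intro ω hω
    refine ⟨?_, Set.mem_univ _⟩
    by_contra hb
    simp only [bad₁, bad₂, bad₃, Set.mem_union, Set.mem_iUnion, Set.mem_preimage, Set.mem_ofPred_eq,
      not_or, not_exists, not_not, ne_eq] at hb
    obtain ⟨⟨hb1, hb2⟩, hb3⟩ := hb
    obtain ⟨j, s, hjs⟩ := exists_threshold_le_score hcm hi hb1 hb2
    obtain ⟨j', s', h1, h2⟩ := output_crowdLearner (erm := erm) (c := c) (n := n) (T := T) (N := N) (a := a) (θ := θ) ω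
      ⟨j, s, (hθ _).2 hjs⟩
    have h3 := informative_of_threshold_le_score hT hb1 hb2 (hη j' s') ((hθ _).1 h1)
    refine hb3 (j', s') ⟨h3, ?_⟩
    rw [← h2]
    exact hω
  have hprod : (P.inputLaw η D).real ((bad₁ ∪ bad₂ ∪ bad₃) ×ˢ Set.univ) = ν.real (bad₁ ∪ bad₂ ∪ bad₃) :=
    inputLaw_prod_univ P _
  refine (measureReal_mono hsub).trans (hprod.le.trans ?_)
  have hb1 : ν.real bad₁ ≤ T * (2 * Real.exp (-(n * (1 - 2 * M) ^ 2 / 2))) := by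
    refine (measureReal_iUnion_fintype_le _).trans ?_
    refine (Finset.sum_le_sum fun e _ => (measureReal_preimage_le (measurePreserving_eval
      (fun _ : Fin (T + N) => dataLaw η D) (Fin.castAdd N e)) _).trans
      (measure_majority_ne_le hn hM hav)).trans ?_
    simp
  have hb2 : ν.real bad₂ ≤ (n * 2 : ℕ) * (2 * Real.exp (-(T * (g / 8) ^ 2 / 2))) := by
    refine (measureReal_iUnion_fintype_le _).trans ?_
    refine (Finset.sum_le_sum fun p _ => (measureReal_preimage_le (measurePreserving_precomp
      (dataLaw η D) (Fin.castAdd_injective T N)) _).trans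
      (measure_deviates_le hcm (by positivity) p hT)).trans ?_
    rw [Finset.sum_const, Finset.card_univ, nsmul_eq_mul]
    simp
  have hb3 : ν.real bad₃ ≤
      (n * 2 : ℕ) * ((2 * N + 1) ^ d * Real.exp (-(N * ((1 / ((a : ℝ) + 1)) ^ 2 / 16) * ε))) := by
    refine (measureReal_iUnion_fintype_le _).trans ?_
    refine (Finset.sum_le_sum (g := fun _ => (2 * (N : ℝ) + 1) ^ d *
      Real.exp (-(N * ((1 / ((a : ℝ) + 1)) ^ 2 / 16) * ε))) fun p _ => (measureReal_preimage_le
      (measurePreserving_precomp (dataLaw η D) (Fin.natAdd_injective N T)) _).trans ?_).trans ?_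
    · by_cases hp : g / 4 ≤ 1 - 2 * (η p.1 p.2 : ℝ)
      · simp only [hp, true_and]
        refine measure_paddedSample_error_le hCm hC hE hc (hη p.1) ?_ N ε
        have ha0 : (0 : ℝ) ≤ a := by positivity
        have := mul_le_mul_of_nonneg_left hp ha0
        linarith
      · simp only [hp, false_and, Set.ofPred_false, measureReal_empty]
        positivity
    · rw [Finset.sum_const, Finset.card_univ, nsmul_eq_mul]
      simp
  have := measureReal_union_le (μ := ν) (bad₁ ∪ bad₂) bad₃
  have := measureReal_union_le (μ := ν) bad₁ bad₂
  linarith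

end Crowd

end CrowdPAC

end

noncomputable section

namespace CrowdPAC

/-! ## The choice of the parameters -/

/-- The parameters of the learner: `g` bounds from below the advantage of the best worker. -/
structure Params (n d : ℕ) (ε δ g : ℝ) : Prop where
  n_pos : 0 < n
  d_pos : 0 < d
  ε_pos : 0 < ε
  ε_le : ε ≤ 1
  δ_pos : 0 < δ
  δ_le : δ ≤ 1 / 2
  g_pos : 0 < g
  g_le : g ≤ 1

/-- The number of ground-truth points. -/
def truthDraws (n : ℕ) (δ g : ℝ) : ℕ := ⌈640 * (Real.log (n / δ) / g ^ 2)⌉₊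

/-- The number of copies of a sample point. -/
def copies (g : ℝ) : ℕ := ⌈8 / g⌉₊

/-- The inverse of the rate at which the error probability of the minimiser decays. -/
def invRate (ε g : ℝ) : ℝ := 16 * (copies g + 1) ^ 2 / ε

/-- The number of sample points. -/
def sampleDraws (n d : ℕ) (ε δ g : ℝ) : ℕ :=
  ⌈1 + 2 * (invRate ε g * d) * Real.log (4 * (invRate ε g * d)) +
    2 * invRate ε g * Real.log (4 * (n / δ))⌉₊

/-- The threshold for the scores. -/
def threshold (n : ℕ) (δ g : ℝ) : ℕ := ⌈(truthDraws n δ g : ℝ) * (1 + 3 * g / 8)⌉₊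

lemma log_two_bounds : 0.69 < Real.log 2 ∧ Real.log 2 < 0.7 :=
  ⟨by linarith [Real.log_two_gt_d9], by linarith [Real.log_two_lt_d9]⟩

lemma pow_le_exp {k : ℕ} : (2.7 : ℝ) ^ k ≤ Real.exp k := by
  rw [← Real.exp_one_pow]
  exact pow_le_pow_left₀ (by norm_num) (by linarith [Real.exp_one_gt_d9]) k

lemma le_truthDraws (n : ℕ) (δ g : ℝ) : 640 * (Real.log (n / δ) / g ^ 2) ≤ truthDraws n δ g := Nat.le_ceil _

lemma le_sampleDraws (n d : ℕ) (ε δ g : ℝ) : 1 + 2 * (invRate ε g * d) * Real.log (4 * (invRate ε g * d)) +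
    2 * invRate ε g * Real.log (4 * (n / δ)) ≤ sampleDraws n d ε δ g := Nat.le_ceil _

namespace Params

variable {n d : ℕ} {ε δ g : ℝ} (p : Params n d ε δ g)

include p

lemma one_le_n : (1 : ℝ) ≤ n := by exact_mod_cast p.n_pos

lemma one_le_d : (1 : ℝ) ≤ d := by exact_mod_cast p.d_pos

lemma two_le_div : 2 ≤ (n : ℝ) / δ := by
  rw [le_div_iff₀ p.δ_pos]; linarith [p.one_le_n, p.δ_le]

lemma log_two_le_log_inv : Real.log 2 ≤ Real.log (1 / δ) :=
  Real.log_le_log (by norm_num) (by rw [le_div_iff₀ p.δ_pos]; linarith [p.δ_le])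

lemma log_two_le : Real.log 2 ≤ Real.log (n / δ) := Real.log_le_log (by norm_num) p.two_le_div

lemma log_div : Real.log (n / δ) = Real.log n + Real.log (1 / δ) := by
  rw [← Real.log_mul (by linarith [p.one_le_n]) (by have := p.δ_pos; positivity)]
  congr 1; ring

lemma truthDraws_pos : 0 < truthDraws n δ g := by
  have := p.log_two_le
  have := log_two_bounds
  have := p.g_pos
  exact Nat.ceil_pos.2 (mul_pos (by norm_num) (div_pos (by linarith) (by positivity)))

lemma truthDraws_lt : (truthDraws n δ g : ℝ) < 640 * (Real.log (n / δ) / g ^ 2) + 1 := by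
  have := p.log_two_le
  have := log_two_bounds
  exact Nat.ceil_lt_add_one (mul_nonneg (by norm_num) (div_nonneg (by linarith) (by positivity)))

lemma eight_le_copies_mul : 8 ≤ copies g * g := by
  rw [← div_le_iff₀ p.g_pos]; exact Nat.le_ceil _

lemma copies_add_one_le : (copies g : ℝ) + 1 ≤ 10 / g := by
  have h1 : (copies g : ℝ) < 8 / g + 1 := Nat.ceil_lt_add_one (by have := p.g_pos; positivity)
  have h2 : 1 ≤ 1 / g := by rw [le_div_iff₀ p.g_pos]; linarith [p.g_le]
  have h3 : 10 / g = 8 / g + 2 * (1 / g) := by ring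
  linarith

lemma invRate_pos : 0 < invRate ε g := by
  have := p.ε_pos
  unfold invRate; positivity

lemma sixteen_le_invRate : 16 ≤ invRate ε g := by
  have := p.ε_pos
  have := p.ε_le
  unfold invRate
  rw [le_div_iff₀ p.ε_pos]
  nlinarith [sq_nonneg (copies g : ℝ), (copies g).cast_nonneg (α := ℝ)]

lemma invRate_le : invRate ε g ≤ 1600 * (1 / g ^ 2 / ε) := by
  have := p.ε_pos
  have hg := p.g_pos
  have h : ((copies g : ℝ) + 1) ^ 2 ≤ (10 / g) ^ 2 :=
    pow_le_pow_left₀ (by positivity) p.copies_add_one_le 2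
  calc invRate ε g ≤ 16 * (10 / g) ^ 2 / ε := by unfold invRate; gcongr
    _ = 1600 * (1 / g ^ 2 / ε) := by ring

lemma one_le_invRate_mul : 1 ≤ invRate ε g * d := by
  nlinarith [p.sixteen_le_invRate, p.one_le_d]

lemma one_le_four_mul_div : 1 ≤ 4 * ((n : ℝ) / δ) := by linarith [p.two_le_div]

lemma sampleDraws_lt : (sampleDraws n d ε δ g : ℝ) <
    1 + 2 * (invRate ε g * d) * Real.log (4 * (invRate ε g * d)) +
    2 * invRate ε g * Real.log (4 * (n / δ)) + 1 := by
  have h1 := p.one_le_invRate_mul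
  have h2 := p.invRate_pos
  refine Nat.ceil_lt_add_one (add_nonneg (add_nonneg zero_le_one ?_) ?_)
  · exact mul_nonneg (by linarith) (Real.log_nonneg (by linarith))
  · exact mul_nonneg (by linarith) (Real.log_nonneg p.one_le_four_mul_div)

/-- The constant is `640 = 5 * 128`, where `(g / 8) ^ 2 / 2 = g ^ 2 / 128`. The exponential is thus
at most `(δ / n) ^ 5`, of which one factor absorbs `n` and the other four give `1 / 16`. -/
lemma deviation_le :
    (n * 2 : ℕ) * (2 * Real.exp (-(truthDraws n δ g * (g / 8) ^ 2 / 2))) ≤ δ / 4 := by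
  have hg := p.g_pos
  have hn := p.one_le_n
  have hδ := p.δ_pos
  have h1 : 5 * Real.log (n / δ) ≤ truthDraws n δ g * (g / 8) ^ 2 / 2 := by
    have h := mul_le_mul_of_nonneg_right (le_truthDraws n δ g) (by positivity : 0 ≤ (g / 8) ^ 2 / 2)
    have e : 640 * (Real.log (n / δ) / g ^ 2) * ((g / 8) ^ 2 / 2) = 5 * Real.log (n / δ) := by
      field_simp; ring
    rw [e] at h
    linarith
  have h2 : Real.exp (-(truthDraws n δ g * (g / 8) ^ 2 / 2)) ≤ (δ / n) ^ 5 := by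
    calc Real.exp (-(truthDraws n δ g * (g / 8) ^ 2 / 2)) ≤ Real.exp ((5 : ℕ) * -Real.log (n / δ)) :=
          Real.exp_le_exp.2 (by push_cast; linarith)
      _ = (δ / n) ^ 5 := by
        rw [Real.exp_nat_mul, Real.exp_neg, Real.exp_log (by positivity), inv_div]
  have h3 : δ / n ≤ 1 / 2 := by
    rw [div_le_iff₀ (by linarith)]; linarith [p.δ_le]
  have h4 : (δ / n) ^ 5 ≤ (δ / n) * (1 / 2) ^ 4 := by
    have : (δ / n) ^ 4 ≤ (1 / 2) ^ 4 := pow_le_pow_left₀ (by positivity) h3 4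
    calc (δ / n) ^ 5 = δ / n * (δ / n) ^ 4 := by ring
      _ ≤ _ := by gcongr
  calc ((n * 2 : ℕ) : ℝ) * (2 * Real.exp (-(truthDraws n δ g * (g / 8) ^ 2 / 2)))
      ≤ (n * 2 : ℕ) * (2 * ((δ / n) * (1 / 2) ^ 4)) := by gcongr; exact h2.trans h4
    _ = δ / 4 := by push_cast; field_simp; norm_num

/-- The number of votes is `O(t)` for `t = truthSize n δ b`, since `1 - 2 * b ≤ g`. Of the exponent
`50 * log (t / δ)`, one unit yields `δ / t` and the other `49` pay for the constants. -/
lemma majority_le {M b : ℝ} (hM : M < 1 / 2) (hb0 : 0 ≤ b) (hb : b < 1 / 2) (hbg : 1 - 2 * b ≤ g)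
    (hA : 100 * (Real.log (truthSize n δ b / δ) / (1 - 2 * M) ^ 2) ≤ n) :
    truthDraws n δ g * (2 * Real.exp (-(n * (1 - 2 * M) ^ 2 / 2))) ≤ δ / 4 := by
  have hδ := p.δ_pos
  have hl := p.log_two_le
  have hl2 := log_two_bounds
  have hb' : 0 < 1 - 2 * b := by linarith
  set t := truthSize n δ b with ht
  have ht0 : 0.69 ≤ t := by
    rw [ht, truthSize, le_div_iff₀ (by positivity)]
    nlinarith
  have hT : (truthDraws n δ g : ℝ) ≤ 642 * t := by
    have h1 : Real.log (n / δ) / g ^ 2 ≤ t := by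
      rw [ht, truthSize]; gcongr; linarith
    linarith [p.truthDraws_lt]
  have htδ : 1.38 ≤ t / δ := by
    rw [le_div_iff₀ hδ]; linarith [p.δ_le]
  set ℓ := Real.log (t / δ)
  have hℓ : 0.27 ≤ ℓ := by
    have h := Real.one_sub_inv_le_log_of_pos (show (0 : ℝ) < t / δ by linarith)
    have h2 : (t / δ)⁻¹ ≤ (1.38 : ℝ)⁻¹ := inv_anti₀ (by norm_num) htδ
    have h3 : (1.38 : ℝ)⁻¹ ≤ 0.73 := by norm_num
    linarith
  have hM' : 0 < (1 - 2 * M) ^ 2 := by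
    have : 0 < 1 - 2 * M := by linarith
    positivity
  have h1 : 50 * ℓ ≤ n * (1 - 2 * M) ^ 2 / 2 := by
    rw [← mul_div_assoc, div_le_iff₀ hM'] at hA
    linarith
  -- `5136 = 4 * 2 * 642`: the target `δ / 4`, the factor `2` of the vote bound, and `T ≤ 642 * t`.
  have h9 : (5136 : ℝ) ≤ Real.exp (49 * ℓ) := by
    have h := pow_le_exp (k := 9)
    have h' : (5136 : ℝ) ≤ 2.7 ^ 9 := by norm_num
    refine h'.trans (h.trans (Real.exp_le_exp.2 ?_))
    push_cast
    linarith
  have h2 : Real.exp (-(n * (1 - 2 * M) ^ 2 / 2)) ≤ (1 / 5136) * (δ / t) := by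
    calc Real.exp (-(n * (1 - 2 * M) ^ 2 / 2)) ≤ Real.exp (-(49 * ℓ) + -ℓ) :=
          Real.exp_le_exp.2 (by linarith)
      _ = (Real.exp (49 * ℓ))⁻¹ * (δ / t) := by
        rw [Real.exp_add, Real.exp_neg, Real.exp_neg, Real.exp_log (by linarith), inv_div]
      _ ≤ (1 / 5136) * (δ / t) := by
        have : 0 ≤ δ / t := div_nonneg hδ.le (by linarith)
        gcongr
        rw [one_div]; exact inv_anti₀ (by norm_num) h9
  have ht' : 0 < t := by linarith
  calc (truthDraws n δ g : ℝ) * (2 * Real.exp (-(n * (1 - 2 * M) ^ 2 / 2)))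
      ≤ 642 * t * (2 * ((1 / 5136) * (δ / t))) := by gcongr
    _ = δ / 4 := by field_simp; norm_num

lemma sample_le :
    (n * 2 : ℕ) * ((2 * sampleDraws n d ε δ g + 1) ^ d *
      Real.exp (-(sampleDraws n d ε δ g * ((1 / ((copies g : ℝ) + 1)) ^ 2 / 16) * ε))) ≤ δ / 2 := by
  have hδ := p.δ_pos
  have hε := p.ε_pos
  have hn := p.one_le_n
  have hd := p.one_le_d
  have hQ := p.invRate_pos
  have hQd := p.one_le_invRate_mul
  have hN := le_sampleDraws n d ε δ g
  set N : ℝ := (sampleDraws n d ε δ g : ℝ) with hNdef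
  have hN0 : 0 ≤ N := Nat.cast_nonneg _
  set Q := invRate ε g with hQdef
  have e1 : N * ((1 / ((copies g : ℝ) + 1)) ^ 2 / 16) * ε = N / Q := by
    rw [hQdef, invRate]; field_simp
  -- The tangent of the logarithm at `4 * (Q * d)`. Multiplied by `Q * d`, its linear part is about
  -- `N / 2`, so the other half of `N` pays for the remaining terms; hence the factors `2` in
  -- `sampleDraws`.
  have h1 : Real.log (2 * N + 1) ≤ (2 * N + 1) / (4 * (Q * d)) + Real.log (4 * (Q * d)) := by
    have h := Real.log_le_sub_one_of_pos (show 0 < (2 * N + 1) / (4 * (Q * d)) by positivity)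
    rw [Real.log_div (by positivity) (by positivity)] at h
    linarith
  have h2 : Q * (d * Real.log (2 * N + 1)) ≤ (2 * N + 1) / 4 + Q * d * Real.log (4 * (Q * d)) := by
    have h := mul_le_mul_of_nonneg_left h1 (show 0 ≤ Q * d by positivity)
    have e : Q * d * ((2 * N + 1) / (4 * (Q * d)) + Real.log (4 * (Q * d))) =
        (2 * N + 1) / 4 + Q * d * Real.log (4 * (Q * d)) := by field_simp
    rw [e] at h
    linarith
  have h3 : d * Real.log (2 * N + 1) + Real.log (4 * (n / δ)) ≤ N / Q := by
    rw [le_div_iff₀ hQ]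
    nlinarith
  have h4 : (2 * N + 1) ^ d * Real.exp (-(N / Q)) ≤ δ / (4 * n) := by
    have e : (2 * N + 1) ^ d = Real.exp (d * Real.log (2 * N + 1)) := by
      rw [Real.exp_nat_mul, Real.exp_log (by positivity)]
    have e' : δ / (4 * n) = Real.exp (-Real.log (4 * (n / δ))) := by
      rw [Real.exp_neg, Real.exp_log (by positivity)]; field_simp
    rw [e, e', ← Real.exp_add]
    exact Real.exp_le_exp.2 (by linarith)
  rw [e1]
  calc ((n * 2 : ℕ) : ℝ) * ((2 * N + 1) ^ d * Real.exp (-(N / Q))) ≤ (n * 2 : ℕ) * (δ / (4 * n)) := by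
        gcongr
    _ = δ / 2 := by push_cast; field_simp; norm_num

/-- The number of tasks. -/
lemma tasks_le {m B : ℝ} (hm0 : 0 ≤ m) (hm : m < 1 / 2) (hmg : 1 - 2 * m ≤ g)
    (hB : (n + d / ε) * (Real.log (1 / δ) / (1 - 2 * m) ^ 2) ≤ B) :
    1 ≤ Real.log (B + 2) ∧
    (truthDraws n δ g : ℝ) * n + sampleDraws n d ε δ g ≤ 100000 * B * Real.log (B + 2) := by
  have hε := p.ε_pos
  have hn := p.one_le_n
  have hd := p.one_le_d
  have hg := p.g_pos
  have hl2 := log_two_bounds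
  have hℓ := p.log_two_le_log_inv
  have hm' : 0 < 1 - 2 * m := by linarith
  set ℓ := Real.log (1 / δ) with hℓdef
  set μ := 1 / (1 - 2 * m) ^ 2 with hμ
  have hμ1 : 1 ≤ μ := by
    rw [hμ, le_div_iff₀ (by positivity), one_mul]; exact pow_le_one₀ hm'.le (by linarith)
  have hgμ : 1 / g ^ 2 ≤ μ := by rw [hμ]; gcongr
  set q := μ * (d / ε) with hq
  have hdε : 1 ≤ (d : ℝ) / ε := by rw [le_div_iff₀ hε]; linarith [p.ε_le]
  have hq1 : 1 ≤ q := one_le_mul_of_one_le_of_one_le hμ1 hdε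
  have hℓ0 : 0.69 ≤ ℓ := by linarith
  have hB' : (n : ℝ) * μ * ℓ + q * ℓ ≤ B := by
    refine le_trans (le_of_eq ?_) hB
    rw [hq, hμ]; ring
  have hnμ : (n : ℝ) ≤ n * μ := le_mul_of_one_le_right (by linarith) hμ1
  have hnμℓ : 0.69 * ((n : ℝ) * μ) ≤ n * μ * ℓ := by
    rw [mul_comm]; exact mul_le_mul_of_nonneg_left hℓ0 (by linarith)
  have hqℓ : 0.69 * q ≤ q * ℓ := by
    rw [mul_comm]; exact mul_le_mul_of_nonneg_left hℓ0 (by linarith)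
  have hB1 : 1.38 ≤ B := by linarith
  have hnB : (n : ℝ) ≤ 2 * B := by linarith
  have hqB : q ≤ 2 * B := by linarith
  set L := Real.log (B + 2) with hL
  have hL1 : 1 ≤ L := by
    rw [hL, Real.le_log_iff_exp_le (by linarith)]
    linarith [Real.exp_one_lt_d9]
  refine ⟨hL1, ?_⟩
  have hlogn : Real.log n ≤ 0.7 + L := by
    have : Real.log n ≤ Real.log (2 * (B + 2)) := Real.log_le_log (by linarith) (by linarith)
    rw [Real.log_mul (by norm_num) (by linarith)] at this
    linarith
  have hLℓ : 0.69 * L ≤ L * ℓ := by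
    rw [mul_comm]; exact mul_le_mul_of_nonneg_left hℓ0 (by linarith)
  have hℓL : ℓ ≤ L * ℓ := le_mul_of_one_le_left (by linarith) hL1
  -- Since `n ≤ 2 * B`, the part `log n` is absorbed by the logarithm that the soft-O bound permits.
  -- This places the labelling of all ground-truth points by all workers within `B * L`.
  have hΛ : Real.log (n / δ) ≤ 5 * (L * ℓ) := by
    rw [p.log_div, ← hℓdef]
    linarith
  have hT : (truthDraws n δ g : ℝ) * n ≤ 3202 * (B * L) := by
    have h1 : Real.log (n / δ) / g ^ 2 ≤ 5 * (L * ℓ) * μ := by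
      rw [div_eq_mul_one_div]
      have : 0 ≤ Real.log (n / δ) := by linarith [p.log_two_le]
      gcongr
    have h2 : (truthDraws n δ g : ℝ) ≤ 3200 * (L * ℓ * μ) + 1 := by linarith [p.truthDraws_lt]
    have h3 : (truthDraws n δ g : ℝ) * n ≤ (3200 * (L * ℓ * μ) + 1) * n := by gcongr
    have h4 : n * μ * ℓ * L ≤ B * L := by
      have h5 : 0 ≤ q * ℓ := by linarith
      have h6 : n * μ * ℓ ≤ B := by linarith
      gcongr
    have h5 : B ≤ B * L := le_mul_of_one_le_right (by linarith) hL1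
    have e : (3200 * (L * ℓ * μ) + 1) * n = 3200 * (n * μ * ℓ * L) + n := by ring
    linarith
  have hQ : invRate ε g ≤ 1600 * (μ / ε) := by
    refine p.invRate_le.trans ?_
    gcongr
  have hQd : invRate ε g * d ≤ 1600 * q := by
    have h := mul_le_mul_of_nonneg_right hQ (show (0 : ℝ) ≤ d by linarith)
    refine h.trans (le_of_eq ?_)
    rw [hq]; ring
  have hlog : Real.log (4 * (invRate ε g * d)) ≤ 11 * L := by
    have h1 : Real.log (4 * (invRate ε g * d)) ≤ Real.log (12800 * (B + 2)) :=
      Real.log_le_log (by linarith [p.one_le_invRate_mul]) (by linarith)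
    rw [Real.log_mul (x := 12800) (by norm_num) (by linarith)] at h1
    have h2 : Real.log 12800 ≤ 10 := by
      rw [Real.log_le_iff_le_exp (by norm_num)]
      have := pow_le_exp (k := 10)
      norm_num at this ⊢
      linarith
    linarith
  have hlog0 : 0 ≤ Real.log (4 * (invRate ε g * d)) := Real.log_nonneg (by linarith [p.one_le_invRate_mul])
  have hA : 2 * (invRate ε g * d) * Real.log (4 * (invRate ε g * d)) ≤ 70400 * (B * L) := by
    calc 2 * (invRate ε g * d) * Real.log (4 * (invRate ε g * d)) ≤ 2 * (1600 * (2 * B)) * (11 * L) := by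
          exact mul_le_mul (by linarith) hlog hlog0 (by linarith)
      _ = 70400 * (B * L) := by ring
  have hlog4 : Real.log (4 * (n / δ)) ≤ 8 * (L * ℓ) := by
    rw [Real.log_mul (by norm_num) (by linarith [p.two_le_div]),
      show (4 : ℝ) = 2 ^ 2 by norm_num, Real.log_pow]
    push_cast
    linarith
  have hC : 2 * invRate ε g * Real.log (4 * (n / δ)) ≤ 25600 * (B * L) := by
    have h1 : μ / ε * ℓ ≤ B := by
      have : μ / ε ≤ q := by
        rw [hq, div_eq_mul_one_div]; gcongr
      have h2 : μ / ε * ℓ ≤ q * ℓ := mul_le_mul_of_nonneg_right this (by linarith)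
      linarith
    have h0 : 0 ≤ μ / ε := by positivity
    calc 2 * invRate ε g * Real.log (4 * (n / δ)) ≤ 2 * (1600 * (μ / ε)) * (8 * (L * ℓ)) := by
          have : 0 ≤ Real.log (4 * (n / δ)) := Real.log_nonneg p.one_le_four_mul_div
          gcongr
      _ = 25600 * (μ / ε * ℓ * L) := by ring
      _ ≤ 25600 * (B * L) := by gcongr
  have hBL : 1 ≤ B * L := one_le_mul_of_one_le_of_one_le (by linarith) hL1
  linarith [p.sampleDraws_lt]

/-- The running time. -/
lemma time_le {Y : ℝ} (hn : n ≤ Y) (hd : d ≤ Y) (hε : 1 / ε ≤ Y) (hδ : 1 / δ ≤ Y) (hg : 1 / g ≤ Y) :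
    ((crowdLearner n (truthDraws n δ g) (sampleDraws n d ε δ g) (copies g) (threshold n δ g)).time : ℝ) ≤
      10 ^ 9 * Y ^ 9 := by
  have h := time_crowdLearner n (truthDraws n δ g) (sampleDraws n d ε δ g) (copies g) (threshold n δ g)
  set T := truthDraws n δ g with hT
  set N := sampleDraws n d ε δ g with hN
  have h' : ((crowdLearner n T N (copies g) (threshold n δ g)).time : ℝ) ≤
      T + N + (n + 3) * (n + 3) + (threshold n δ g + 1) + 9 * (T * n) + 4 * n + N +
        (N * (copies g + 1) + 1) := by exact_mod_cast h
  refine h'.trans ?_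
  have gp := p.g_pos
  have εp := p.ε_pos
  have δp := p.δ_pos
  have n1 := p.one_le_n
  have Y1 : 1 ≤ Y := n1.trans hn
  have Y0 : 0 ≤ Y := by linarith
  have mono : ∀ {i j : ℕ}, i ≤ j → Y ^ i ≤ Y ^ j := fun hij => pow_le_pow_right₀ Y1 hij
  have hnδ : (n : ℝ) / δ ≤ Y ^ 2 := by
    calc (n : ℝ) / δ = n * (1 / δ) := by ring
      _ ≤ Y * Y := by gcongr
      _ = Y ^ 2 := by ring
  have hgg : 1 / g ^ 2 ≤ Y ^ 2 := by
    calc 1 / g ^ 2 = (1 / g) ^ 2 := by ring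
      _ ≤ Y ^ 2 := by gcongr
  have hTY : (T : ℝ) ≤ 641 * Y ^ 4 := by
    have h1 : Real.log (n / δ) / g ^ 2 ≤ Y ^ 4 := by
      have h2 : Real.log (n / δ) ≤ Y ^ 2 := by
        have := Real.log_le_sub_one_of_pos (show 0 < (n : ℝ) / δ by positivity)
        linarith
      calc Real.log (n / δ) / g ^ 2 = Real.log (n / δ) * (1 / g ^ 2) := by ring
        _ ≤ Y ^ 2 * Y ^ 2 := by gcongr
        _ = Y ^ 4 := by ring
    have h3 : 1 ≤ Y ^ 4 := one_le_pow₀ Y1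
    linarith [p.truthDraws_lt]
  have hθY : (threshold n δ g : ℝ) ≤ 1283 * Y ^ 4 := by
    have h1 : (threshold n δ g : ℝ) < T * (1 + 3 * g / 8) + 1 := Nat.ceil_lt_add_one (by positivity)
    have h2 : (T : ℝ) * (1 + 3 * g / 8) ≤ T * 2 := by
      have := p.g_le
      gcongr; linarith
    have h3 : 1 ≤ Y ^ 4 := one_le_pow₀ Y1
    linarith
  have ha : (copies g : ℝ) + 1 ≤ 10 * Y := by
    have := p.copies_add_one_le
    have e : 10 / g = 10 * (1 / g) := by ring
    linarith
  have hQ : invRate ε g ≤ 1600 * Y ^ 3 := by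
    refine p.invRate_le.trans ?_
    calc 1600 * (1 / g ^ 2 / ε) = 1600 * (1 / g ^ 2 * (1 / ε)) := by ring
      _ ≤ 1600 * (Y ^ 2 * Y) := by gcongr
      _ = 1600 * Y ^ 3 := by ring
  have hQ0 := p.invRate_pos
  have hQd : invRate ε g * d ≤ 1600 * Y ^ 4 := by
    calc invRate ε g * d ≤ 1600 * Y ^ 3 * Y := by gcongr
      _ = 1600 * Y ^ 4 := by ring
  have hQd1 := p.one_le_invRate_mul
  -- Logarithms are bounded by their arguments, which is wasteful but polynomial. The padding
  -- multiplies by `copies g + 1 ≤ 10 * Y`, whence the exponent `9`.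
  have hNY : (N : ℝ) ≤ 20492802 * Y ^ 8 := by
    have h1 : Real.log (4 * (invRate ε g * d)) ≤ 6400 * Y ^ 4 := by
      have := Real.log_le_sub_one_of_pos (show 0 < 4 * (invRate ε g * d) by linarith)
      linarith
    have h2 : Real.log (4 * (n / δ)) ≤ 4 * Y ^ 2 := by
      have := Real.log_le_sub_one_of_pos (show 0 < 4 * ((n : ℝ) / δ) by positivity)
      linarith
    have h3 : 2 * (invRate ε g * d) * Real.log (4 * (invRate ε g * d)) ≤ 20480000 * Y ^ 8 := by
      have h0 : 0 ≤ Real.log (4 * (invRate ε g * d)) := Real.log_nonneg (by linarith)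
      calc _ ≤ 2 * (1600 * Y ^ 4) * (6400 * Y ^ 4) := by gcongr
        _ = 20480000 * Y ^ 8 := by ring
    have h4 : 2 * invRate ε g * Real.log (4 * (n / δ)) ≤ 12800 * Y ^ 8 := by
      have h0 : 0 ≤ Real.log (4 * (n / δ)) := Real.log_nonneg p.one_le_four_mul_div
      calc _ ≤ 2 * (1600 * Y ^ 3) * (4 * Y ^ 2) := by gcongr
        _ = 12800 * Y ^ 5 := by ring
        _ ≤ 12800 * Y ^ 8 := by linarith [mono (show 5 ≤ 8 by norm_num)]
    have h5 : 1 ≤ Y ^ 8 := one_le_pow₀ Y1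
    linarith [p.sampleDraws_lt]
  have hN9 : (N : ℝ) * (copies g + 1) ≤ 204928020 * Y ^ 9 := by
    calc (N : ℝ) * (copies g + 1) ≤ 20492802 * Y ^ 8 * (10 * Y) := by gcongr
      _ = 204928020 * Y ^ 9 := by ring
  have hTn : (T : ℝ) * n ≤ 641 * Y ^ 5 := by
    calc (T : ℝ) * n ≤ 641 * Y ^ 4 * Y := by gcongr
      _ = 641 * Y ^ 5 := by ring
  have hnn : ((n : ℝ) + 3) * (n + 3) ≤ 16 * Y ^ 2 := by nlinarith
  have := mono (show 8 ≤ 9 by norm_num)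
  have := mono (show 5 ≤ 9 by norm_num)
  have := mono (show 4 ≤ 9 by norm_num)
  have := mono (show 2 ≤ 9 by norm_num)
  have := mono (show 1 ≤ 9 by norm_num)
  have : 1 ≤ Y ^ 9 := one_le_pow₀ Y1
  rw [pow_one] at *
  linarith

end Params

/-- The learner that does nothing. -/
def idleLearner : Learner := ⟨0, 0, []⟩

/-- Two concepts that differ at a point shatter that point. -/
lemma eq_of_mem_of_vcDim_eq_zero {X : Type*} {C : Set (X → Bool)} (hC : vcDim C ≤ (0 : ℕ))
    {h h' : X → Bool} (hh : h ∈ C) (hh' : h' ∈ C) : h = h' := by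
  by_contra hne
  obtain ⟨x, hx⟩ := Function.ne_iff.1 hne
  have hs : Shatters C {x} := fun t => by
    by_cases e : h x = t x
    · exact ⟨h, hh, by simpa using e⟩
    · refine ⟨h', hh', ?_⟩
      simp only [Finset.mem_singleton, forall_eq]
      revert hx e
      generalize h x = u
      generalize h' x = v
      generalize t x = w
      revert u v w
      decide
  simpa using hs.card_le hC

/-- The weighted error is a convex combination of the two error rates. -/
lemma weightedError_le {X : Type*} [MeasurableSpace X] {n : ℕ} {η : Fin n → Bool → unitInterval}
    {D : Measure X} [IsProbabilityMeasure D] {c : X → Bool} (hc : Measurable c) {i : Fin n} {m : ℝ}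
    (hm : ∀ l, (η i l : ℝ) ≤ m) : weightedError η D c i ≤ m := by
  have h1 := measure_true_add_measure_false (D := D) hc
  unfold weightedError
  have h2 := mul_le_mul_of_nonneg_right (hm true) (measureReal_nonneg (μ := D) (s := {x | c x = true}))
  have h3 := mul_le_mul_of_nonneg_right (hm false) (measureReal_nonneg (μ := D) (s := {x | c x = false}))
  have h4 : m * D.real {x | c x = true} + m * D.real {x | c x = false} = m := by
    rw [← mul_add, h1, mul_one]
  linarith

lemma taskBound_ge {n d : ℕ} {ε δ M b m : ℝ} :
    (n + d / ε) * (Real.log (1 / δ) / (1 - 2 * m) ^ 2) ≤ taskBound n d ε δ M b m := by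
  unfold taskBound
  have : 0 ≤ Real.log (n / δ) ^ 2 / ((1 - 2 * M) ^ 2 * (1 - 2 * b) ^ 2) := by positivity
  linarith

end CrowdPAC

end

theorem theorem9 :
    -- universal constants
    ∃ (A K : ℝ) (k : ℕ), 0 < A ∧ 0 < K ∧
      ∀ (n d : ℕ) (ε δ M b m : ℝ), 0 < n → 0 < ε → 0 < δ → δ ≤ 1 / 2 →
        0 ≤ M → M < 1 / 2 → 0 ≤ b → b < 1 / 2 → 0 ≤ m → m < 1 / 2 →
        -- the crowd is large enough for a majority vote on each ground-truth data point
        A * (Real.log (CrowdPAC.truthSize n δ b / δ) / (1 - 2 * M) ^ 2) ≤ n →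
        ∃ P : CrowdPAC.Learner,
          -- the soft-O bound on the number of tasks
          (P.tasks : ℝ) ≤ K * CrowdPAC.taskBound n d ε δ M b m *
            Real.log (CrowdPAC.taskBound n d ε δ M b m + 2) ^ k ∧
          -- polynomial running time
          (P.time : ℝ) ≤ K * (n + d + 1 / ε + 1 / δ + 1 / (1 - 2 * M) + 1 / (1 - 2 * b)
            + 1 / (1 - 2 * m)) ^ k ∧
          -- the PAC criterion
          ∀ (X : Type*) [MeasurableSpace X] (C : Set (X → Bool))
            (erm : List (X × Bool) → X → Bool) (D : MeasureTheory.Measure X)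
            [MeasureTheory.IsProbabilityMeasure D] (c : X → Bool)
            (η : Fin n → Bool → unitInterval) (i : Fin n),
            (∀ h ∈ C, Measurable h) → CrowdPAC.vcDim C ≤ d → CrowdPAC.IsMinimizer C erm →
            c ∈ C →
            (∀ j l, (η j l : ℝ) ≤ 1 / 2) →
            -- `i` is a worker of least class-weighted error rate
            (∀ j, CrowdPAC.weightedError η D c i ≤ CrowdPAC.weightedError η D c j) →
            max (CrowdPAC.avgError η true) (CrowdPAC.avgError η false) ≤ M →
            CrowdPAC.weightedError η D c i ≤ b →
            max (η i true : ℝ) (η i false : ℝ) ≤ m →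
            (∀ ω : P.Input X n, P.output erm c ω ∈ C) ∧
            (P.inputLaw η D).real {ω | ε ≤ D.real {x | P.output erm c ω x ≠ c x}} ≤ δ := by
  refine ⟨100, 10 ^ 9, 9, by norm_num, by norm_num, ?_⟩
  intro n d ε δ M b m hn hε hδ hδ' hM0 hM hb0 hb hm0 hm hA
  have hM' : 0 < 1 - 2 * M := by linarith
  have hb' : 0 < 1 - 2 * b := by linarith
  have hm' : 0 < 1 - 2 * m := by linarith
  have hB := CrowdPAC.taskBound_ge (n := n) (d := d) (ε := ε) (δ := δ) (M := M) (b := b) (m := m)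
  -- If `d = 0` the class contains only the target, and if `ε > 1` no hypothesis has error `ε`. The
  -- concept for the empty sample then suffices. Otherwise `d ≥ 1` and `ε ≤ 1`, as `Params`
  -- requires.
  by_cases htriv : d = 0 ∨ 1 < ε
  · refine ⟨CrowdPAC.idleLearner, ?_, ?_, ?_⟩
    · have hB0 : 0 ≤ CrowdPAC.taskBound n d ε δ M b m := by
        refine le_trans ?_ hB
        have : 0 ≤ Real.log (1 / δ) := Real.log_nonneg (by rw [le_div_iff₀ hδ]; linarith)
        positivity
      have : 0 ≤ Real.log (CrowdPAC.taskBound n d ε δ M b m + 2) := Real.log_nonneg (by linarith)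
      simp only [CrowdPAC.idleLearner, CrowdPAC.Learner.tasks, List.countP_nil, Nat.cast_zero]
      positivity
    · simp only [CrowdPAC.idleLearner, CrowdPAC.Learner.time, List.map_nil, List.sum_nil, add_zero,
        Nat.cast_zero]
      positivity
    · intro X _ C erm D _ c η i hCm hC hE hc _ _ _ _ _
      have hout : ∀ ω : CrowdPAC.idleLearner.Input X n,
          CrowdPAC.idleLearner.output erm c ω = erm [] := fun ω => rfl
      refine ⟨fun ω => by rw [hout]; exact hE.mem _, ?_⟩
      simp only [hout]
      have : ¬ ε ≤ D.real {x | erm [] x ≠ c x} := by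
        rcases htriv with h | h
        · subst h
          rw [CrowdPAC.eq_of_mem_of_vcDim_eq_zero hC (hE.mem []) hc]
          simpa using hε
        · exact not_le.2 (lt_of_le_of_lt MeasureTheory.measureReal_le_one h)
      simp [this, hδ.le]
  · push Not at htriv
    -- Both `b` and `m` bound the weighted error of `i`. The larger advantage is used: `1 - 2 * m ≤
    -- g` serves the task bound, and `1 - 2 * b ≤ g` serves the majority votes and the running time.
    set g := 1 - 2 * min b m with hg
    have hgb : 1 - 2 * b ≤ g := by linarith [min_le_left b m]
    have hgm : 1 - 2 * m ≤ g := by linarith [min_le_right b m]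
    have p : CrowdPAC.Params n d ε δ g :=
      { n_pos := hn
        d_pos := Nat.pos_of_ne_zero htriv.1
        ε_pos := hε
        ε_le := htriv.2
        δ_pos := hδ
        δ_le := hδ'
        g_pos := by linarith
        g_le := by linarith [le_min hb0 hm0] }
    refine ⟨CrowdPAC.crowdLearner n (CrowdPAC.truthDraws n δ g) (CrowdPAC.sampleDraws n d ε δ g)
      (CrowdPAC.copies g) (CrowdPAC.threshold n δ g), ?_, ?_, ?_⟩
    · obtain ⟨hL, ht⟩ := p.tasks_le hm0 hm hgm hB
      set B := CrowdPAC.taskBound n d ε δ M b m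
      rw [CrowdPAC.tasks_crowdLearner]
      have hB0 : 0 ≤ B := by
        refine le_trans ?_ hB
        have : 0 ≤ Real.log (1 / δ) := Real.log_nonneg (by rw [le_div_iff₀ hδ]; linarith)
        positivity
      push_cast
      refine ht.trans ?_
      have h1 : Real.log (B + 2) ≤ Real.log (B + 2) ^ 9 := le_self_pow₀ hL (by norm_num)
      gcongr
      norm_num
    · have a1 : 0 < 1 / ε := by positivity
      have a2 : 0 < 1 / δ := by positivity
      have a3 : 0 < 1 / (1 - 2 * M) := by positivity
      have a4 : 0 < 1 / (1 - 2 * b) := by positivity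
      have a5 : 0 < 1 / (1 - 2 * m) := by positivity
      have a6 : (0 : ℝ) ≤ n := by positivity
      have a7 : (0 : ℝ) ≤ d := by positivity
      have a8 : 1 / g ≤ 1 / (1 - 2 * b) := one_div_le_one_div_of_le hb' hgb
      exact p.time_le (by linarith) (by linarith) (by linarith) (by linarith) (by linarith)
    · intro X _ C erm D _ c η i hCm hC hE hc hη _ hav hwb hwm
      refine ⟨fun ω => CrowdPAC.output_crowdLearner_mem hE.mem ω, ?_⟩
      have hw : CrowdPAC.weightedError η D c i ≤ min b m :=
        le_min hwb (CrowdPAC.weightedError_le (hCm c hc) fun l => by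
          cases l
          · exact (le_max_right _ _).trans hwm
          · exact (le_max_left _ _).trans hwm)
      refine (CrowdPAC.measure_crowdLearner_error_le hn hCm hC hE hc hη hM (fun l => by
          cases l
          · exact (le_max_right _ _).trans hav
          · exact (le_max_left _ _).trans hav) p.g_pos.le (i := i) (by linarith) p.truthDraws_pos
        p.eight_le_copies_mul (fun v => Nat.ceil_le) ε).trans ?_
      -- The failure budget is `δ / 4` for the votes, `δ / 4` for the scores and `δ / 2` for the
      -- minimiser.
      have h1 := p.majority_le hM hb0 hb hgb hA
      have h2 := p.deviation_le
      have h3 := p.sample_le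
      linarith
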